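/- **Setting.** Let $n$ agents have rotations $R_1,\dots,R_n\in SO(3)$ with kinematics $\dot R_i=R_i\widehat{\omega}_i$, where $\widehat{p}$ is the skew-symmetric matrix with $\widehat{p}\,v=p\times v$. Equip $SO(3)$ with the Riemannian distance $d(R,S)=\arccos\big((\operatorname{trace}(R^TS)-1)/2\big)$ and $SO(3)^n$ with the product distance $\big(\sum_i d(R_i,S_i)^2\big)^{1/2}$. Let $B_r(I)$ and $\bar B_q(I)$ be the open and closed geodesic balls around the identity. A *local representation* is given by $0<r\le\pi$ and an odd, analytic, strictly increasing function $g:(-r,r)\to\mathbb R$ such that $f(R)=g(\theta)u$ is a diffeomorphism from $B_r(I)$ onto the open ball of radius $r'=\sup g\in(0,\infty]$ around $0$ in $\mathbb R^3$. Here $\theta=d(I,R)$ and $u=\frac{1}{2\sin\theta}(r_{32}-r_{23},\,r_{13}-r_{31},\,r_{21}-r_{12})^T$ is the rotation axis of $R=[r_{ij}]$, with $f(I)=0$. Put $y_{ij}=f(R_i^TR_j)$. Fix weights $a_{ij}>0$. At each time $t\in\mathbb R$ agent $i$ has a neighborhood $\mathcal N_i(t)\subset\{1,\dots,n\}$ with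 $i\in\mathcal N_i(t)$. Each $t\mapsto\mathcal N_i(t)$ is piecewise constant and right-continuous, with a lower bound $\tau_D>0$ on the time between consecutive switches. The pair $(i,j)$ is an edge at time $t$ if and only if $j\in\mathcal N_i(t)$. The controller is $$\omega_i=\sum_{j\in\mathcal N_i(t)}a_{ij}\,y_{ij}.$$ **Proposition.** Suppose that at every time $t$ and for each pair $(i,j)$, at least one of $(i,j)$ and $(j,i)$ is an edge, and suppose that there is $k>0$ with $g(\theta)\ge k\theta$ for all $\theta\in[0,r)$. Let $q<r/2$. Then the set $$\mathcal S=\{(R_1,\dots,R_n)\in(\bar B_q(I))^n: R_1=\dots=R_n\}$$ is globally exponentially stable relative to the strongly forward-invariant set $(\bar B_q(I))^n$ for the closed-loop dynamics, in the Riemannian metric. That is: 1. $(\bar B_q(I))^n$ is strongly forward-invariant: for every right-continuous, piecewise constant signal, with finitely many switches on every compact time interval, that switches between arbitrary digraphs with self-loops on $\{1,\dots,n\}$, and for every initial time $t_0$ and every initial state in $(\bar B_q(I))^n$, the closed-loop solution exists, is unique, is defined for all $t\ge t_0$, and stays in $(\bar B_q(I))^n$. 2. There are constants $c,\lambda>0$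 such that, for the given time-varying neighborhoods, every initial time $t_0$ and every closed-loop solution $R$ with $R(t_0)\in(\bar B_q(I))^n$, $$\operatorname{dist}(R(t),\mathcal S)\le c\,e^{-\lambda(t-t_0)}\operatorname{dist}(R(t_0),\mathcal S)\qquad\text{for all }t\ge t_0,$$ where $\operatorname{dist}$ is the product Riemannian distance to the set. -/

import Mathlib

open Set Filter Topology
open scoped Matrix ENNReal ContDiff

/-- The rotation group `SO(3)` of real `3 × 3` matrices. -/
abbrev SO3 : Type := Matrix.specialOrthogonalGroup (Fin 3) ℝ

/-- Euclidean three-space. -/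
abbrev E3 : Type := EuclideanSpace ℝ (Fin 3)

-- A norm on `3 × 3` matrices, needed to speak of derivatives of matrix-valued functions.
attribute [local instance] Matrix.frobeniusNormedAddCommGroup Matrix.frobeniusNormedSpace

/-- The hat map: `hat p` is the skew-symmetric matrix of the cross product with `p`. -/
def hat (p : E3) : Matrix (Fin 3) (Fin 3) ℝ :=
  !![0, -p 2, p 1;
     p 2, 0, -p 0;
     -p 1, p 0, 0]

/-- The rotation angle `θ = arccos ((trace M - 1) / 2)`. For a rotation `M` this is the
Riemannian distance from the identity, for the bi-invariant metric on `SO(3)` in which the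
tangent vector `R * hat ω` at `R` has length `‖ω‖`. -/
noncomputable def rotAngle (M : Matrix (Fin 3) (Fin 3) ℝ) : ℝ :=
  Real.arccos ((M.trace - 1) / 2)

/-- The rotation axis `u` of a rotation whose angle lies in `(0, π)`.
It is `0` by convention if the sine of the angle vanishes. -/
noncomputable def rotAxis (M : Matrix (Fin 3) (Fin 3) ℝ) : E3 :=
  (1 / (2 * Real.sin (rotAngle M))) •
    !₂[M 2 1 - M 1 2, M 0 2 - M 2 0, M 1 0 - M 0 1]

/-- The Riemannian distance on `SO(3)`: the angle of the relative rotation `Rᵀ S`. -/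
noncomputable def rotDist (R S : SO3) : ℝ :=
  rotAngle ((R : Matrix (Fin 3) (Fin 3) ℝ)ᵀ * (S : Matrix (Fin 3) (Fin 3) ℝ))

/-- The map `f(R) = g(θ) u`. -/
noncomputable def localRep (g : ℝ → ℝ) (M : Matrix (Fin 3) (Fin 3) ℝ) : E3 :=
  g (rotAngle M) • rotAxis M

/-- The open geodesic ball of radius `r` around the identity, as a set of matrices. -/
def openRotBall (r : ℝ) : Set (Matrix (Fin 3) (Fin 3) ℝ) :=
  {M | ∃ R : SO3, (R : Matrix (Fin 3) (Fin 3) ℝ) = M ∧ rotDist 1 R < r}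

/-- Smoothness of a map on an arbitrary subset of a normed space: near each point of the
subset the map is the restriction of a smooth map defined on an open set. -/
def SmoothOnSubset {E F : Type*} [NormedAddCommGroup E] [NormedSpace ℝ E]
    [NormedAddCommGroup F] [NormedSpace ℝ F] (f : E → F) (X : Set E) : Prop :=
  ∀ x ∈ X, ∃ U : Set E, IsOpen U ∧ x ∈ U ∧
    ∃ f' : E → F, ContDiffOn ℝ ∞ f' U ∧ EqOn f f' (X ∩ U)

/-- `f` restricts to a diffeomorphism from the subset `X` onto the subset `Y`. -/
def IsDiffeoBetween {E F : Type*} [NormedAddCommGroup E] [NormedSpace ℝ E]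
    [NormedAddCommGroup F] [NormedSpace ℝ F] (f : E → F) (X : Set E) (Y : Set F) : Prop :=
  SmoothOnSubset f X ∧
    ∃ h : F → E, SmoothOnSubset h Y ∧ MapsTo f X Y ∧ MapsTo h Y X ∧ InvOn h f X Y

/-- The function `g`, used on `(-r, r)`, gives a local representation `R ↦ g(θ) u` of rotations:
`g` is odd, analytic and strictly increasing, and `R ↦ g(θ) u` is a diffeomorphism from the open
geodesic ball of radius `r ≤ π` onto the open ball of radius `r' = sup g` (possibly `∞`). -/
structure IsLocalRepresentation (r : ℝ) (g : ℝ → ℝ) : Prop where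
  r_pos : 0 < r
  r_le_pi : r ≤ Real.pi
  odd : ∀ s ∈ Ioo (-r) r, g (-s) = -g s
  analytic : AnalyticOnNhd ℝ g (Ioo (-r) r)
  strictMono : StrictMonoOn g (Ioo (-r) r)
  diffeo : IsDiffeoBetween (localRep g) (openRotBall r)
    {v : E3 | ENNReal.ofReal ‖v‖ < ⨆ s ∈ Ioo 0 r, ENNReal.ofReal (g s)}

/-- The times at which a signal fails to be locally constant. -/
def switchTimes {α : Type*} (s : ℝ → α) : Set ℝ :=
  {t | ¬ ∀ᶠ u in 𝓝 t, s u = s t}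

/-- A piecewise constant, right-continuous signal with more than `τD` time between any two
switches. -/
structure HasDwellTime {α : Type*} (τD : ℝ) (s : ℝ → α) : Prop where
  right_cont : ∀ t, ∀ᶠ u in 𝓝[>] t, s u = s t
  dwell : ∀ t ∈ switchTimes s, ∀ t' ∈ switchTimes s, t < t' → τD < t' - t

/-- A piecewise constant, right-continuous signal with finitely many switches on every compact
time interval. -/
structure IsWellBehaved {α : Type*} (s : ℝ → α) : Prop where
  right_cont : ∀ t, ∀ᶠ u in 𝓝[>] t, s u = s t
  locally_finite : ∀ b c : ℝ, (switchTimes s ∩ Icc b c).Finite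

/-- The control law `ω_i = ∑_{j ∈ 𝒩_i} a_ij y_ij`, where `y_ij` is the local representation of the
relative rotation `R_iᵀ R_j`. -/
noncomputable def controlLaw {n : ℕ} (a : Fin n → Fin n → ℝ) (g : ℝ → ℝ)
    (N : Fin n → Finset (Fin n)) (R : Fin n → SO3) (i : Fin n) : E3 :=
  ∑ j ∈ N i, a i j •
    localRep g ((R i : Matrix (Fin 3) (Fin 3) ℝ)ᵀ * (R j : Matrix (Fin 3) (Fin 3) ℝ))

/-- `R` solves the closed loop kinematics `dR_i/dt = R_i * hat ω_i` on the time set `J`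
(an interval `[t₀, T)` or `[t₀, ∞)`) for the time-varying neighborhoods `N t i`. At a switching
time a solution has only one-sided derivatives. As the signal is right-continuous, a continuous
curve satisfies the equation between the switching times if and only if it satisfies the equation
at all times with the right derivative. -/
def IsSolutionOn {n : ℕ} (a : Fin n → Fin n → ℝ) (g : ℝ → ℝ)
    (N : ℝ → Fin n → Finset (Fin n)) (J : Set ℝ) (R : ℝ → Fin n → SO3) : Prop :=
  ContinuousOn R J ∧
    ∀ t ∈ J, ∀ i, HasDerivWithinAt (fun s => (R s i : Matrix (Fin 3) (Fin 3) ℝ))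
      ((R t i : Matrix (Fin 3) (Fin 3) ℝ) * hat (controlLaw a g (N t) (R t) i)) (Ici t) t

/-- Strong forward invariance of `D` for the closed loop system: for every well-behaved signal
switching between the digraphs with self-loops, every initial time and every initial state in
`D`, the solution exists, is unique, forward complete and stays in `D`. -/
def StronglyForwardInvariant {n : ℕ} (a : Fin n → Fin n → ℝ) (g : ℝ → ℝ)
    (D : Set (Fin n → SO3)) : Prop :=
  ∀ N : ℝ → Fin n → Finset (Fin n), IsWellBehaved N → (∀ t i, i ∈ N t i) →
    ∀ t₀ : ℝ, ∀ R₀ ∈ D, ∃ R : ℝ → Fin n → SO3,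
      IsSolutionOn a g N (Ici t₀) R ∧ R t₀ = R₀ ∧ (∀ t ≥ t₀, R t ∈ D) ∧
      ∀ (T : ℝ) (R' : ℝ → Fin n → SO3), IsSolutionOn a g N (Ico t₀ T) R' → R' t₀ = R₀ →
        ∀ t ∈ Ico t₀ T, R' t = R t

/-- The product Riemannian distance on `SO(3)^n`. -/
noncomputable def configDist {n : ℕ} (R S : Fin n → SO3) : ℝ :=
  Real.sqrt (∑ i, rotDist (R i) (S i) ^ 2)

/-- The Riemannian distance from a configuration to a set of configurations. -/
noncomputable def configDistToSet {n : ℕ} (R : Fin n → SO3) (D : Set (Fin n → SO3)) : ℝ :=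
  sInf (configDist R '' D)

/-- `D₁` is globally exponentially stable relative to `D₂` for the closed loop system with
time-varying neighborhoods `N`, in the Riemannian metric and uniformly in the initial time. -/
def GloballyExponentiallyStableRel {n : ℕ} (a : Fin n → Fin n → ℝ) (g : ℝ → ℝ)
    (N : ℝ → Fin n → Finset (Fin n)) (D₁ D₂ : Set (Fin n → SO3)) : Prop :=
  ∃ c > 0, ∃ lam > 0, ∀ (t₀ : ℝ) (R : ℝ → Fin n → SO3),
    IsSolutionOn a g N (Ici t₀) R → R t₀ ∈ D₂ → ∀ t ≥ t₀,
      configDistToSet (R t) D₁ ≤ c * Real.exp (-lam * (t - t₀)) * configDistToSet (R t₀) D₁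

/-- The set of configurations whose rotations lie in the closed geodesic ball of radius `q` around
the identity. -/
def closedRotBallPow (n : ℕ) (q : ℝ) : Set (Fin n → SO3) :=
  {R | ∀ i, rotDist 1 (R i) ≤ q}

/-- The synchronized configurations in the closed geodesic ball of radius `q`. -/
def synchronizedSet (n : ℕ) (q : ℝ) : Set (Fin n → SO3) :=
  {R | R ∈ closedRotBallPow n q ∧ ∀ i j, R i = R j}

/-! Distances are measured by traces: for a rotation of angle `θ` the trace is `1 + 2 cos θ`, and `3
- trace` is half the squared chordal (Frobenius) distance to the identity. The relative trace of two
agents has derivative `⟪axialVec (RᵢᵀRⱼ), ωᵢ⟫ + ⟪axialVec (RⱼᵀRᵢ), ωⱼ⟫`, and for angles below `r`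
the vector `localRep g M` is a nonnegative multiple of `axialVec M`. So only the signs of inner
products between directions pointing from one agent to others matter.

These signs come from spherical geometry. Rotations of angle below `π / 2` lift to unit quaternions
`p`, `q`, `s` with pairwise positive inner products, and the angle at `p` between the directions to
`q` and `s` has the sign of `⟪q,s⟫ - ⟪p,q⟫⟪p,s⟫`. This is nonnegative once `⟪p,q⟫ ≤ ⟪q,s⟫`, that is,
once the side `pq` is at least as long as `qs` (`SO3.inner_axialVec_nonneg`).

Invariance: an agent farthest from `1` sees all its neighbors in directions not pointing away from
`1`, so it does not move outward (`mem_closedRotBallPow_of_solution`). Stability: in a pair at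
maximal relative distance neither agent moves away from the other, and the one that has the edge
approaches at a rate proportional to `3 - trace`. Hence the largest relative `3 - trace` decays
exponentially under any switching (`three_sub_trace_le_of_solution`), and it is comparable to the
squared Riemannian distance to the synchronized set.

Existence and uniqueness come from extending the local representation to a Lipschitz map on all
matrices, solving in matrix space, and checking that solutions remain in `SO(3)` and in the ball. A
uniform existence time allows continuation through all switches. -/

/-! ### Rotation matrices and unit quaternions -/

/-- The axial vector of the skew-symmetric matrix `A - Aᵀ`. -/
noncomputable def axialVec (A : Matrix (Fin 3) (Fin 3) ℝ) : E3 :=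
  !₂[A 2 1 - A 1 2, A 0 2 - A 2 0, A 1 0 - A 0 1]

/-- The matrix of the rotation `v ↦ p v p̄` for the quaternion `p = w + x i + y j + z k`. -/
def quatMat (w x y z : ℝ) : Matrix (Fin 3) (Fin 3) ℝ :=
  !![w ^ 2 + x ^ 2 - y ^ 2 - z ^ 2, 2 * (x * y - w * z), 2 * (x * z + w * y);
     2 * (x * y + w * z), w ^ 2 - x ^ 2 + y ^ 2 - z ^ 2, 2 * (y * z - w * x);
     2 * (x * z - w * y), 2 * (y * z + w * x), w ^ 2 - x ^ 2 - y ^ 2 + z ^ 2]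

lemma localRep_eq_smul_axialVec (g : ℝ → ℝ) (M : Matrix (Fin 3) (Fin 3) ℝ) :
    localRep g M = (g (rotAngle M) / (2 * Real.sin (rotAngle M))) • axialVec M := by
  rw [localRep, rotAxis, axialVec, smul_smul]
  congr 1
  ring

lemma inner_E3 (x y : E3) : inner ℝ x y = x 0 * y 0 + x 1 * y 1 + x 2 * y 2 := by
  simp [PiLp.inner_apply, Fin.sum_univ_three]
  ring

lemma axialVec_transpose (A : Matrix (Fin 3) (Fin 3) ℝ) : axialVec Aᵀ = -axialVec A := by
  ext i
  fin_cases i <;> simp [axialVec]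

lemma SO3.transpose_mul_self (R : SO3) :
    (R : Matrix (Fin 3) (Fin 3) ℝ)ᵀ * (R : Matrix (Fin 3) (Fin 3) ℝ) = 1 := by
  have h := (Matrix.mem_specialOrthogonalGroup_iff.1 R.2).1
  simpa using (Matrix.mem_orthogonalGroup_iff' (Fin 3) ℝ).1 h

lemma SO3.mul_transpose_self (R : SO3) :
    (R : Matrix (Fin 3) (Fin 3) ℝ) * (R : Matrix (Fin 3) (Fin 3) ℝ)ᵀ = 1 :=
  mul_eq_one_comm.1 R.transpose_mul_self

lemma SO3.det_eq_one (R : SO3) : (R : Matrix (Fin 3) (Fin 3) ℝ).det = 1 :=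
  (Matrix.mem_specialOrthogonalGroup_iff.1 R.2).2

lemma mem_SO3_iff (M : Matrix (Fin 3) (Fin 3) ℝ) :
    M ∈ Matrix.specialOrthogonalGroup (Fin 3) ℝ ↔ Mᵀ * M = 1 ∧ M.det = 1 := by
  rw [Matrix.mem_specialOrthogonalGroup_iff, Matrix.mem_orthogonalGroup_iff']

/-- A rotation matrix is its own cofactor matrix. -/
lemma SO3.transpose_eq_adjugate (R : SO3) :
    (R : Matrix (Fin 3) (Fin 3) ℝ)ᵀ = (R : Matrix (Fin 3) (Fin 3) ℝ).adjugate := by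
  have h1 : (R : Matrix (Fin 3) (Fin 3) ℝ) * (R : Matrix (Fin 3) (Fin 3) ℝ).adjugate = 1 := by
    rw [Matrix.mul_adjugate, R.det_eq_one, one_smul]
  calc (R : Matrix (Fin 3) (Fin 3) ℝ)ᵀ
      = (R : Matrix (Fin 3) (Fin 3) ℝ)ᵀ * (R * (R : Matrix (Fin 3) (Fin 3) ℝ).adjugate) := by
        rw [h1, mul_one]
    _ = _ := by rw [← mul_assoc, R.transpose_mul_self, one_mul]

/-- A rotation by an angle less than `π` comes from a unit quaternion with positive real part. -/
lemma SO3.exists_quatMat (R : SO3) (h : 0 < 1 + (R : Matrix (Fin 3) (Fin 3) ℝ).trace) :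
    ∃ w x y z : ℝ, 0 < w ∧ 4 * w ^ 2 = 1 + (R : Matrix (Fin 3) (Fin 3) ℝ).trace ∧
      w ^ 2 + x ^ 2 + y ^ 2 + z ^ 2 = 1 ∧ (R : Matrix (Fin 3) (Fin 3) ℝ) = quatMat w x y z := by
  have ho := R.transpose_mul_self
  have ho' := R.mul_transpose_self
  have hc := R.transpose_eq_adjugate
  generalize (R : Matrix (Fin 3) (Fin 3) ℝ) = A at *
  set w := Real.sqrt ((1 + A.trace) / 4) with hw
  have hwpos : 0 < w := Real.sqrt_pos.2 (by linarith)
  have hw2 : w ^ 2 = (1 + A.trace) / 4 := Real.sq_sqrt (by linarith)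
  have htr : A.trace = A 0 0 + A 1 1 + A 2 2 := Matrix.trace_fin_three A
  have hinv : w * w⁻¹ = 1 := mul_inv_cancel₀ hwpos.ne'
  have hinv2 : (1 + A.trace) * w⁻¹ ^ 2 = 4 := by
    have : (1 + A.trace) = 4 * w ^ 2 := by linarith
    rw [this]; field_simp
  have o := fun i j => congrFun (congrFun ho i) j
  have o' := fun i j => congrFun (congrFun ho' i) j
  have c := fun i j => congrFun (congrFun hc i) j
  simp only [Matrix.mul_apply, Fin.sum_univ_three, Matrix.transpose_apply] at o o'
  simp only [Matrix.adjugate_fin_three, Matrix.transpose_apply] at c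
  have o00 := o 0 0
  have o11 := o 1 1
  have o22 := o 2 2
  have o01 := o 0 1
  have o02 := o 0 2
  have o12 := o 1 2
  have p00 := o' 0 0
  have p11 := o' 1 1
  have p22 := o' 2 2
  have p01 := o' 0 1
  have p02 := o' 0 2
  have p12 := o' 1 2
  have c00 := c 0 0
  have c01 := c 0 1
  have c02 := c 0 2
  have c10 := c 1 0
  have c11 := c 1 1
  have c12 := c 1 2
  have c20 := c 2 0
  have c21 := c 2 1
  have c22 := c 2 2
  clear o o' c
  simp at o00 o11 o22 o01 o02 o12 p00 p11 p22 p01 p02 p12 c00 c01 c02 c10 c11 c12 c20 c21 c22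
  generalize A.trace = τ at *
  subst htr
  -- The vector part of the quaternion is the axial vector divided by `4w`. The six identities
  -- express the products of its components; they need the cofactor equations, which is where
  -- determinant `1` enters, and not only orthogonality.
  have e0 : (A 0 2 - A 2 0) ^ 2 + (A 1 0 - A 0 1) ^ 2 =
      2 * (1 + (A 0 0 + A 1 1 + A 2 2)) * (1 - A 0 0) := by
    linear_combination p00 + o00 - 2 * c11 - 2 * c22
  have e1 : (A 2 1 - A 1 2) ^ 2 + (A 1 0 - A 0 1) ^ 2 =
      2 * (1 + (A 0 0 + A 1 1 + A 2 2)) * (1 - A 1 1) := by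
    linear_combination p11 + o11 - 2 * c00 - 2 * c22
  have e2 : (A 2 1 - A 1 2) ^ 2 + (A 0 2 - A 2 0) ^ 2 =
      2 * (1 + (A 0 0 + A 1 1 + A 2 2)) * (1 - A 2 2) := by
    linear_combination p22 + o22 - 2 * c00 - 2 * c11
  have sxy : (A 2 1 - A 1 2) * (A 0 2 - A 2 0) =
      (1 + (A 0 0 + A 1 1 + A 2 2)) * (A 0 1 + A 1 0) := by
    linear_combination -c01 - c10 - o01 - p01
  have sxz : (A 2 1 - A 1 2) * (A 1 0 - A 0 1) =
      (1 + (A 0 0 + A 1 1 + A 2 2)) * (A 0 2 + A 2 0) := by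
    linear_combination -c02 - c20 - o02 - p02
  have syz : (A 0 2 - A 2 0) * (A 1 0 - A 0 1) =
      (1 + (A 0 0 + A 1 1 + A 2 2)) * (A 1 2 + A 2 1) := by
    linear_combination -c12 - c21 - o12 - p12
  refine ⟨w, (A 2 1 - A 1 2) * w⁻¹ / 4, (A 0 2 - A 2 0) * w⁻¹ / 4, (A 1 0 - A 0 1) * w⁻¹ / 4,
    hwpos, by linarith, ?_, ?_⟩
  · linear_combination hw2 + w⁻¹ ^ 2 / 32 * (e0 + e1 + e2) +
      (3 - A 0 0 - A 1 1 - A 2 2) / 16 * hinv2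
  · ext i j
    fin_cases i <;> fin_cases j <;> simp only [quatMat, Matrix.of_apply, Matrix.cons_val',
      Matrix.cons_val_zero, Matrix.cons_val_one, Matrix.cons_val, Fin.zero_eta, Fin.mk_one,
      Fin.reduceFinMk, Fin.isValue]
    · linear_combination -hw2 - w⁻¹ ^ 2 / 32 * (e1 + e2 - 3 * e0) -
        (1 + 3 * A 0 0 - A 1 1 - A 2 2 - 2) / 16 * hinv2
    · linear_combination -w⁻¹ ^ 2 / 8 * sxy - (A 0 1 + A 1 0) / 8 * hinv2 +
        (A 1 0 - A 0 1) / 2 * hinv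
    · linear_combination -w⁻¹ ^ 2 / 8 * sxz - (A 0 2 + A 2 0) / 8 * hinv2 -
        (A 0 2 - A 2 0) / 2 * hinv
    · linear_combination -w⁻¹ ^ 2 / 8 * sxy - (A 0 1 + A 1 0) / 8 * hinv2 -
        (A 1 0 - A 0 1) / 2 * hinv
    · linear_combination -hw2 - w⁻¹ ^ 2 / 32 * (e0 + e2 - 3 * e1) -
        (1 + 3 * A 1 1 - A 0 0 - A 2 2 - 2) / 16 * hinv2
    · linear_combination -w⁻¹ ^ 2 / 8 * syz - (A 1 2 + A 2 1) / 8 * hinv2 +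
        (A 2 1 - A 1 2) / 2 * hinv
    · linear_combination -w⁻¹ ^ 2 / 8 * sxz - (A 0 2 + A 2 0) / 8 * hinv2 +
        (A 0 2 - A 2 0) / 2 * hinv
    · linear_combination -w⁻¹ ^ 2 / 8 * syz - (A 1 2 + A 2 1) / 8 * hinv2 -
        (A 2 1 - A 1 2) / 2 * hinv
    · linear_combination -hw2 - w⁻¹ ^ 2 / 32 * (e0 + e1 - 3 * e2) -
        (1 + 3 * A 2 2 - A 0 0 - A 1 1 - 2) / 16 * hinv2

/-- The relative rotation belongs to `p̄p'`, whose real part is the Euclidean inner product of `p`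
and `p'`. -/
lemma trace_quatMat_transpose_mul (w x y z w' x' y' z' : ℝ) :
    ((quatMat w x y z)ᵀ * quatMat w' x' y' z').trace =
      4 * (w * w' + x * x' + y * y' + z * z') ^ 2 -
        (w ^ 2 + x ^ 2 + y ^ 2 + z ^ 2) * (w' ^ 2 + x' ^ 2 + y' ^ 2 + z' ^ 2) := by
  simp [quatMat, Matrix.trace_fin_three, Matrix.mul_apply, Fin.sum_univ_three]
  ring

/-- The vector on the right is the imaginary part of `p̄p'`. -/
lemma axialVec_quatMat_transpose_mul (w x y z w' x' y' z' : ℝ) :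
    axialVec ((quatMat w x y z)ᵀ * quatMat w' x' y' z') =
      (4 * (w * w' + x * x' + y * y' + z * z')) •
        !₂[w * x' - x * w' - (y * z' - z * y'), w * y' - y * w' - (z * x' - x * z'),
          w * z' - z * w' - (x * y' - y * x')] := by
  ext i
  fin_cases i <;> simp [axialVec, quatMat, Matrix.mul_apply, Fin.sum_univ_three] <;> ring

/-- Both sides are `4 sin² θ`, since the trace is `1 + 2 cos θ`. -/
lemma SO3.norm_axialVec_sq (R : SO3) (h : 0 < 1 + (R : Matrix (Fin 3) (Fin 3) ℝ).trace) :
    inner ℝ (axialVec (R : Matrix (Fin 3) (Fin 3) ℝ)) (axialVec (R : Matrix (Fin 3) (Fin 3) ℝ)) =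
      (3 - (R : Matrix (Fin 3) (Fin 3) ℝ).trace) * (1 + (R : Matrix (Fin 3) (Fin 3) ℝ).trace) := by
  obtain ⟨w, x, y, z, hw, htr, hn, hR⟩ := R.exists_quatMat h
  have ht : (R : Matrix (Fin 3) (Fin 3) ℝ).trace = 4 * w ^ 2 - 1 := by linarith
  rw [ht, hR, inner_E3]
  simp [axialVec, quatMat]
  linear_combination 16 * w ^ 2 * hn

/-- A form of the triangle inequality: `2w² - 1` is the cosine of the rotation angle, while the
inner product is the cosine of half the relative angle. It also shows that the lifts with positive
real part have positive inner product, so no sign choice is left. -/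
lemma quat_inner_pos {w x y z w' x' y' z' : ℝ} (hw : 0 < w) (hw' : 0 < w')
    (h : w ^ 2 + x ^ 2 + y ^ 2 + z ^ 2 = 1) (h' : w' ^ 2 + x' ^ 2 + y' ^ 2 + z' ^ 2 = 1)
    {c : ℝ} (hc : c ≤ 2 * w ^ 2 - 1) (hc' : c ≤ 2 * w' ^ 2 - 1) (hc0 : 0 < c) :
    c ≤ w * w' + x * x' + y * y' + z * z' := by
  have h1 : -(x * x' + y * y' + z * z') ≤ (1 - c) / 2 := by
    nlinarith [sq_nonneg (x + x'), sq_nonneg (y + y'), sq_nonneg (z + z')]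
  have h2 : (1 + c) / 2 ≤ w * w' := by
    by_contra hlt
    push Not at hlt
    have : (w * w') ^ 2 < ((1 + c) / 2) ^ 2 := by
      apply pow_lt_pow_left₀ hlt (by positivity) (by norm_num)
    have h3 : ((1 + c) / 2) * ((1 + c) / 2) ≤ w ^ 2 * w' ^ 2 :=
      mul_le_mul (by linarith) (by linarith) (by positivity) (by positivity)
    nlinarith
  linarith

/-- In a geodesic triangle of rotations close to the identity, the angle at an endpoint of a side
that is at least as long as the opposite side is not obtuse. -/
lemma SO3.inner_axialVec_nonneg {P Q S : SO3}
    (hP : 1 < (P : Matrix (Fin 3) (Fin 3) ℝ).trace) (hQ : 1 < (Q : Matrix (Fin 3) (Fin 3) ℝ).trace)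
    (hS : 1 < (S : Matrix (Fin 3) (Fin 3) ℝ).trace)
    (h : ((P : Matrix (Fin 3) (Fin 3) ℝ)ᵀ * (Q : Matrix (Fin 3) (Fin 3) ℝ)).trace ≤
      ((Q : Matrix (Fin 3) (Fin 3) ℝ)ᵀ * (S : Matrix (Fin 3) (Fin 3) ℝ)).trace) :
    0 ≤ inner ℝ (axialVec ((P : Matrix (Fin 3) (Fin 3) ℝ)ᵀ * (Q : Matrix (Fin 3) (Fin 3) ℝ)))
      (axialVec ((P : Matrix (Fin 3) (Fin 3) ℝ)ᵀ * (S : Matrix (Fin 3) (Fin 3) ℝ))) := by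
  obtain ⟨w, x, y, z, hw, htr, hn, hR⟩ := P.exists_quatMat (by linarith)
  obtain ⟨w', x', y', z', hw', htr', hn', hR'⟩ := Q.exists_quatMat (by linarith)
  obtain ⟨w'', x'', y'', z'', hw'', htr'', hn'', hR''⟩ := S.exists_quatMat (by linarith)
  have hpq := (lt_min (show 0 < 2 * w ^ 2 - 1 by linarith)
    (show 0 < 2 * w' ^ 2 - 1 by linarith)).trans_le (quat_inner_pos hw hw' hn hn'
    (min_le_left (2 * w ^ 2 - 1) (2 * w' ^ 2 - 1)) (min_le_right _ _)
    (lt_min (by linarith) (by linarith)))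
  have hps := (lt_min (show 0 < 2 * w ^ 2 - 1 by linarith)
    (show 0 < 2 * w'' ^ 2 - 1 by linarith)).trans_le (quat_inner_pos hw hw'' hn hn''
    (min_le_left (2 * w ^ 2 - 1) (2 * w'' ^ 2 - 1)) (min_le_right _ _)
    (lt_min (by linarith) (by linarith)))
  have hqs := (lt_min (show 0 < 2 * w' ^ 2 - 1 by linarith)
    (show 0 < 2 * w'' ^ 2 - 1 by linarith)).trans_le (quat_inner_pos hw' hw'' hn' hn''
    (min_le_left (2 * w' ^ 2 - 1) (2 * w'' ^ 2 - 1)) (min_le_right _ _)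
    (lt_min (by linarith) (by linarith)))
  rw [hR, hR', hR'', trace_quatMat_transpose_mul, trace_quatMat_transpose_mul, hn, hn', hn''] at h
  rw [hR, hR', hR'', axialVec_quatMat_transpose_mul, axialVec_quatMat_transpose_mul,
    real_inner_smul_left, real_inner_smul_right]
  -- This is the inner product of the components of `q` and `s` orthogonal to `p`, as in the
  -- spherical law of cosines.
  have e : inner ℝ (!₂[w * x' - x * w' - (y * z' - z * y'), w * y' - y * w' - (z * x' - x * z'),
      w * z' - z * w' - (x * y' - y * x')] : E3)
      !₂[w * x'' - x * w'' - (y * z'' - z * y''), w * y'' - y * w'' - (z * x'' - x * z''),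
      w * z'' - z * w'' - (x * y'' - y * x'')] =
      (w' * w'' + x' * x'' + y' * y'' + z' * z'') - (w * w' + x * x' + y * y' + z * z') *
        (w * w'' + x * x'' + y * y'' + z * z'') := by
    rw [inner_E3]
    simp
    linear_combination (w' * w'' + x' * x'' + y' * y'' + z' * z'') * hn
  rw [e]
  have h1 : w * w'' + x * x'' + y * y'' + z * z'' ≤ 1 := by
    nlinarith [sq_nonneg (w - w''), sq_nonneg (x - x''), sq_nonneg (y - y''), sq_nonneg (z - z'')]
  have h2 : w * w' + x * x' + y * y' + z * z' ≤ w' * w'' + x' * x'' + y' * y'' + z' * z'' :=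
    (sq_le_sq₀ hpq.le hqs.le).1 (by linarith)
  have h3 := mul_le_mul_of_nonneg_left h1 hpq.le
  have : 0 ≤ (w' * w'' + x' * x'' + y' * y'' + z' * z'') - (w * w' + x * x' + y * y' + z * z') *
        (w * w'' + x * x'' + y * y'' + z * z'') := by linarith
  positivity

/-- Rotations within angle `q < π / 2` of the identity are within angle `2 * q` of each other. -/
lemma SO3.trace_transpose_mul_ge {P Q : SO3} {c : ℝ} (hc : 0 < c)
    (hP : 1 + 2 * c ≤ (P : Matrix (Fin 3) (Fin 3) ℝ).trace)
    (hQ : 1 + 2 * c ≤ (Q : Matrix (Fin 3) (Fin 3) ℝ).trace) :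
    4 * c ^ 2 - 1 ≤ ((P : Matrix (Fin 3) (Fin 3) ℝ)ᵀ * (Q : Matrix (Fin 3) (Fin 3) ℝ)).trace := by
  obtain ⟨w, x, y, z, hw, htr, hn, hR⟩ := P.exists_quatMat (by linarith)
  obtain ⟨w', x', y', z', hw', htr', hn', hR'⟩ := Q.exists_quatMat (by linarith)
  have h := quat_inner_pos hw hw' hn hn' (c := c) (by linarith) (by linarith) hc
  rw [hR, hR', trace_quatMat_transpose_mul, hn, hn']
  nlinarith

lemma SO3.trace_le_three (R : SO3) : (R : Matrix (Fin 3) (Fin 3) ℝ).trace ≤ 3 := by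
  by_cases h : 0 < 1 + (R : Matrix (Fin 3) (Fin 3) ℝ).trace
  · obtain ⟨w, x, y, z, hw, htr, hn, hR⟩ := R.exists_quatMat h
    nlinarith [sq_nonneg x, sq_nonneg y, sq_nonneg z]
  · linarith

/-! ### Derivatives of relative traces -/

/-- The Frobenius inner product with the hat matrix only sees the axial vector. -/
lemma trace_mul_hat (A : Matrix (Fin 3) (Fin 3) ℝ) (p : E3) :
    (A * hat p).trace = -inner ℝ (axialVec A) p := by
  rw [inner_E3]
  simp [hat, axialVec, Matrix.trace_fin_three, Matrix.mul_apply, Fin.sum_univ_three]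
  ring

lemma hat_transpose (p : E3) : (hat p)ᵀ = -hat p := by
  ext i j
  fin_cases i <;> fin_cases j <;> simp [hat]

/-- Entrywise criterion for derivatives of matrix-valued curves. -/
lemma hasDerivWithinAt_matrix_iff {F : ℝ → Matrix (Fin 3) (Fin 3) ℝ}
    {F' : Matrix (Fin 3) (Fin 3) ℝ} {s : Set ℝ} {t : ℝ} :
    HasDerivWithinAt F F' s t ↔
      ∀ i j, HasDerivWithinAt (fun u => F u i j) (F' i j) s t := by
  let e : Matrix (Fin 3) (Fin 3) ℝ ≃L[ℝ] (Fin 3 → Fin 3 → ℝ) :=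
    (Matrix.ofLinearEquiv ℝ).symm.toContinuousLinearEquiv
  have h : HasDerivWithinAt F F' s t ↔ HasDerivWithinAt (fun u => e (F u)) (e F') s t := by
    refine ⟨fun h => e.hasFDerivAt.comp_hasDerivWithinAt t h, fun h => ?_⟩
    have h2 := e.symm.hasFDerivAt.comp_hasDerivWithinAt t h
    exact h2
  rw [h, hasDerivWithinAt_pi]
  exact forall_congr' fun i => hasDerivWithinAt_pi

lemma HasDerivWithinAt.trace_transpose_mul {F G : ℝ → Matrix (Fin 3) (Fin 3) ℝ}
    {F' G' : Matrix (Fin 3) (Fin 3) ℝ} {s : Set ℝ} {t : ℝ}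
    (hF : HasDerivWithinAt F F' s t) (hG : HasDerivWithinAt G G' s t) :
    HasDerivWithinAt (fun u => ((F u)ᵀ * G u).trace)
      ((F'ᵀ * G t).trace + ((F t)ᵀ * G').trace) s t := by
  rw [hasDerivWithinAt_matrix_iff] at hF hG
  simp only [Matrix.trace, Matrix.diag, Matrix.mul_apply, Matrix.transpose_apply]
  rw [← Finset.sum_add_distrib]
  refine HasDerivWithinAt.fun_sum fun i _ => ?_
  rw [← Finset.sum_add_distrib]
  exact HasDerivWithinAt.fun_sum fun j _ => (hF j i).mul (hG j i)

lemma HasDerivWithinAt.transpose_mul {F G : ℝ → Matrix (Fin 3) (Fin 3) ℝ}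
    {F' G' : Matrix (Fin 3) (Fin 3) ℝ} {s : Set ℝ} {t : ℝ}
    (hF : HasDerivWithinAt F F' s t) (hG : HasDerivWithinAt G G' s t) :
    HasDerivWithinAt (fun u => (F u)ᵀ * G u) (F'ᵀ * G t + (F t)ᵀ * G') s t := by
  rw [hasDerivWithinAt_matrix_iff] at hF hG ⊢
  intro i j
  simp only [Matrix.add_apply, Matrix.mul_apply, Matrix.transpose_apply]
  rw [← Finset.sum_add_distrib]
  exact HasDerivWithinAt.fun_sum fun l _ => (hF l i).mul (hG l j)

/-- The trace of the relative rotation of two curves that rotate with body velocities `p`, `p'`. -/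
lemma hasDerivWithinAt_trace_relative {F G : ℝ → Matrix (Fin 3) (Fin 3) ℝ} {p p' : E3}
    {s : Set ℝ} {t : ℝ} (hF : HasDerivWithinAt F (F t * hat p) s t)
    (hG : HasDerivWithinAt G (G t * hat p') s t) :
    HasDerivWithinAt (fun u => ((F u)ᵀ * G u).trace)
      (inner ℝ (axialVec ((F t)ᵀ * G t)) p + inner ℝ (axialVec ((G t)ᵀ * F t)) p') s t := by
  convert hF.trace_transpose_mul hG using 1
  have h1 : ((F t * hat p)ᵀ * G t).trace = ((G t)ᵀ * F t * hat p).trace := by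
    rw [← Matrix.trace_transpose]
    simp [Matrix.transpose_mul, Matrix.mul_assoc]
  have h2 : axialVec ((F t)ᵀ * G t) = -axialVec ((G t)ᵀ * F t) := by
    rw [← axialVec_transpose, Matrix.transpose_mul, Matrix.transpose_transpose]
  rw [h1, ← Matrix.mul_assoc, trace_mul_hat, trace_mul_hat, h2, inner_neg_left, inner_neg_left,
    neg_neg]

/-! ### A barrier argument for finite families -/

/-- A finite family of continuous functions stays nonpositive if the right derivative of each is
negative whenever it vanishes while the others are nonpositive. -/
lemma nonpos_of_right_deriv_neg {ι : Type*} [Finite ι] {h : ι → ℝ → ℝ} {a b : ℝ}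
    (hcont : ∀ i, ContinuousOn (h i) (Icc a b)) (ha : ∀ i, h i a ≤ 0)
    (hderiv : ∀ i, ∀ t ∈ Ico a b, h i t = 0 → (∀ j, h j t ≤ 0) →
      ∃ d < 0, HasDerivWithinAt (h i) d (Ici t) t) :
    ∀ t ∈ Icc a b, ∀ i, h i t ≤ 0 := by
  have key : Icc a b ⊆ {t | ∀ i, h i t ≤ 0} := by
    refine IsClosed.Icc_subset_of_forall_exists_gt ?_ ha ?_
    · have : {t | ∀ i, h i t ≤ 0} ∩ Icc a b = Icc a b ∩ ⋂ i, (Icc a b ∩ (h i) ⁻¹' Iic 0) := by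
        ext t
        simp only [mem_inter_iff, mem_ofPred_eq, mem_iInter, mem_preimage, mem_Iic]
        exact ⟨fun h => ⟨h.2, fun i => ⟨h.2, h.1 i⟩⟩, fun h => ⟨fun i => (h.2 i).2, h.1⟩⟩
      rw [this]
      exact isClosed_Icc.inter (isClosed_iInter fun i =>
        (hcont i).preimage_isClosed_of_isClosed isClosed_Icc isClosed_Iic)
    · rintro t ⟨ht, htI⟩ y hy
      have ev : ∀ i, ∀ᶠ u in 𝓝[>] t, h i u ≤ 0 := by
        intro i
        rcases (ht i).lt_or_eq with hlt | heq
        · have hc : ContinuousWithinAt (h i) (Ioi t) t :=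
            ((hcont i t ⟨htI.1, htI.2.le⟩).mono_of_mem_nhdsWithin
              (mem_of_superset (Ioc_mem_nhdsGT htI.2) fun u hu => ⟨htI.1.trans hu.1.le, hu.2⟩))
          exact (hc.eventually (gt_mem_nhds hlt)).mono fun u hu => hu.le
        · obtain ⟨d, hd, hder⟩ := hderiv i t htI heq ht
          have hs := (hasDerivWithinAt_iff_tendsto_slope' self_notMem_Ioi).1
            (hder.mono Ioi_subset_Ici_self)
          filter_upwards [hs.eventually (gt_mem_nhds hd), self_mem_nhdsWithin]
            with u hu hut
          rw [slope_def_field, heq, sub_zero, div_lt_iff₀ (sub_pos.2 hut), zero_mul] at hu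
          exact hu.le
      have hI : ∀ᶠ u in 𝓝[>] t, u ∈ Ioc t y := Ioc_mem_nhdsGT hy
      obtain ⟨u, hu1, hu2⟩ := ((eventually_all.2 ev).and hI).exists
      exact ⟨u, hu1, hu2⟩
  exact fun t ht => key ht

/-! ### Angles and geodesic balls in terms of traces -/

lemma one_add_two_cos_le_trace {M : Matrix (Fin 3) (Fin 3) ℝ} {q : ℝ}
    (hq : q < Real.pi) (h : rotAngle M ≤ q) : 1 + 2 * Real.cos q ≤ M.trace := by
  -- `Real.arccos` is constant `π` below `-1` and `0` above `1`. As `M` is an arbitrary matrix, both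
  -- ranges are treated separately.
  have h1 : -1 < (M.trace - 1) / 2 := by
    by_contra hle
    push Not at hle
    rw [rotAngle, Real.arccos_of_le_neg_one hle] at h
    linarith
  by_cases h2 : (M.trace - 1) / 2 ≤ 1
  · have := Real.cos_le_cos_of_nonneg_of_le_pi (Real.arccos_nonneg _) hq.le h
    rw [Real.cos_arccos h1.le h2] at this
    linarith
  · have := Real.cos_le_one q
    linarith

lemma rotAngle_le {M : Matrix (Fin 3) (Fin 3) ℝ} {q : ℝ} (hq0 : 0 ≤ q) (hq : q ≤ Real.pi)
    (h : 1 + 2 * Real.cos q ≤ M.trace) : rotAngle M ≤ q := by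
  rw [rotAngle, ← Real.arccos_cos hq0 hq]
  exact Real.arccos_le_arccos (by linarith)

lemma rotDist_one (R : SO3) : rotDist 1 R = rotAngle (R : Matrix (Fin 3) (Fin 3) ℝ) := by
  simp [rotDist]

lemma mem_closedRotBallPow_iff {n : ℕ} {q : ℝ} (hq0 : 0 ≤ q) (hq : q < Real.pi)
    {R : Fin n → SO3} : R ∈ closedRotBallPow n q ↔
      ∀ i, 1 + 2 * Real.cos q ≤ (R i : Matrix (Fin 3) (Fin 3) ℝ).trace := by
  refine forall_congr' fun i => ?_
  rw [rotDist_one]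
  exact ⟨one_add_two_cos_le_trace hq, rotAngle_le hq0 hq.le⟩

lemma one_lt_trace_of_mem_closedRotBallPow {n : ℕ} {q : ℝ} (hq0 : 0 ≤ q) (hq : q < Real.pi / 2)
    {R : Fin n → SO3} (hR : R ∈ closedRotBallPow n q) (i : Fin n) :
    1 < (R i : Matrix (Fin 3) (Fin 3) ℝ).trace := by
  have h := (mem_closedRotBallPow_iff hq0 (by linarith [Real.pi_pos])).1 hR i
  have := Real.cos_pos_of_mem_Ioo ⟨by linarith, hq⟩
  linarith

lemma trace_relative_ge {n : ℕ} {q : ℝ} (hq0 : 0 ≤ q) (hq : q < Real.pi / 2)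
    {R : Fin n → SO3} (hR : R ∈ closedRotBallPow n q) (i j : Fin n) :
    4 * Real.cos q ^ 2 - 1 ≤
      ((R i : Matrix (Fin 3) (Fin 3) ℝ)ᵀ * (R j : Matrix (Fin 3) (Fin 3) ℝ)).trace := by
  have h := (mem_closedRotBallPow_iff hq0 (by linarith [Real.pi_pos])).1 hR
  exact SO3.trace_transpose_mul_ge (Real.cos_pos_of_mem_Ioo ⟨by linarith, hq⟩) (h i) (h j)

lemma rotAngle_relative_le {n : ℕ} {q : ℝ} (hq0 : 0 ≤ q) (hq : q < Real.pi / 2)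
    {R : Fin n → SO3} (hR : R ∈ closedRotBallPow n q) (i j : Fin n) :
    rotAngle ((R i : Matrix (Fin 3) (Fin 3) ℝ)ᵀ * (R j : Matrix (Fin 3) (Fin 3) ℝ)) ≤ 2 * q := by
  refine rotAngle_le (by linarith) (by linarith) ?_
  rw [Real.cos_two_mul]
  linarith [trace_relative_ge hq0 hq hR i j]

lemma SO3.coe_transpose_mul (P Q : SO3) :
    ((P⁻¹ * Q : SO3) : Matrix (Fin 3) (Fin 3) ℝ) =
      (P : Matrix (Fin 3) (Fin 3) ℝ)ᵀ * (Q : Matrix (Fin 3) (Fin 3) ℝ) := rfl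

lemma hat_zero : hat 0 = 0 := by
  ext i j
  fin_cases i <;> fin_cases j <;> simp [hat]

lemma trace_transpose_mul_comm (A B : Matrix (Fin 3) (Fin 3) ℝ) :
    (Aᵀ * B).trace = (Bᵀ * A).trace := by
  rw [← Matrix.trace_transpose, Matrix.transpose_mul, Matrix.transpose_transpose]

/-! ### The control law: no outward motion, and contraction along an edge -/

section ControlLaw

variable {n : ℕ} {r : ℝ} {g : ℝ → ℝ} {k : ℝ} {a : Fin n → Fin n → ℝ}

lemma localRep_coeff_nonneg (hk : 0 < k) (hgk : ∀ θ ∈ Ico 0 r, k * θ ≤ g θ)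
    {M : Matrix (Fin 3) (Fin 3) ℝ} (hM : rotAngle M < r) :
    0 ≤ g (rotAngle M) / (2 * Real.sin (rotAngle M)) := by
  have h0 : 0 ≤ rotAngle M := Real.arccos_nonneg _
  have hs : 0 ≤ Real.sin (rotAngle M) := Real.sin_nonneg_of_nonneg_of_le_pi h0 (Real.arccos_le_pi _)
  have hg : 0 ≤ g (rotAngle M) := (mul_nonneg hk.le h0).trans (hgk _ ⟨h0, hM⟩)
  positivity

/-- The linear lower bound on `g` combines with `sin θ ≤ θ`. -/
lemma le_localRep_coeff (hk : 0 < k) (hgk : ∀ θ ∈ Ico 0 r, k * θ ≤ g θ)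
    {M : Matrix (Fin 3) (Fin 3) ℝ} (hM : rotAngle M < r) (hs : 0 < Real.sin (rotAngle M)) :
    k / 2 ≤ g (rotAngle M) / (2 * Real.sin (rotAngle M)) := by
  have h0 : 0 ≤ rotAngle M := Real.arccos_nonneg _
  rw [le_div_iff₀ (by positivity)]
  have h1 := hgk _ ⟨h0, hM⟩
  have h2 := mul_le_mul_of_nonneg_left (Real.sin_le h0) hk.le
  linarith

lemma le_inner_axialVec_localRep (hk : 0 < k) (hgk : ∀ θ ∈ Ico 0 r, k * θ ≤ g θ)
    {R : SO3} (hR : 0 < 1 + (R : Matrix (Fin 3) (Fin 3) ℝ).trace)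
    (hM : rotAngle (R : Matrix (Fin 3) (Fin 3) ℝ) < r) :
    k / 2 * ((3 - (R : Matrix (Fin 3) (Fin 3) ℝ).trace) *
        (1 + (R : Matrix (Fin 3) (Fin 3) ℝ).trace)) ≤
      inner ℝ (axialVec (R : Matrix (Fin 3) (Fin 3) ℝ))
        (localRep g (R : Matrix (Fin 3) (Fin 3) ℝ)) := by
  rw [localRep_eq_smul_axialVec, real_inner_smul_right, R.norm_axialVec_sq hR]
  have h3 := R.trace_le_three
  -- At the identity the quotient by the sine is a default value, but the factor `3 - trace` makes
  -- both sides vanish.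
  rcases h3.eq_or_lt with h | h
  · simp [h]
  · have hs : 0 < Real.sin (rotAngle (R : Matrix (Fin 3) (Fin 3) ℝ)) := by
      refine Real.sin_pos_of_pos_of_lt_pi (Real.arccos_pos.2 (by linarith)) ?_
      exact (Real.arccos_le_pi _).lt_of_ne (Real.arccos_eq_pi.not.2 (by linarith))
    exact mul_le_mul_of_nonneg_right (le_localRep_coeff hk hgk hM hs)
      (mul_nonneg (by linarith) hR.le)

lemma inner_axialVec_localRep_nonneg (hk : 0 < k) (hgk : ∀ θ ∈ Ico 0 r, k * θ ≤ g θ) {P Q S : SO3}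
    (hP : 1 < (P : Matrix (Fin 3) (Fin 3) ℝ).trace) (hQ : 1 < (Q : Matrix (Fin 3) (Fin 3) ℝ).trace)
    (hS : 1 < (S : Matrix (Fin 3) (Fin 3) ℝ).trace)
    (h : ((P : Matrix (Fin 3) (Fin 3) ℝ)ᵀ * (Q : Matrix (Fin 3) (Fin 3) ℝ)).trace ≤
      ((Q : Matrix (Fin 3) (Fin 3) ℝ)ᵀ * (S : Matrix (Fin 3) (Fin 3) ℝ)).trace)
    (hr : rotAngle ((P : Matrix (Fin 3) (Fin 3) ℝ)ᵀ * (S : Matrix (Fin 3) (Fin 3) ℝ)) < r) :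
    0 ≤ inner ℝ (axialVec ((P : Matrix (Fin 3) (Fin 3) ℝ)ᵀ * (Q : Matrix (Fin 3) (Fin 3) ℝ)))
      (localRep g ((P : Matrix (Fin 3) (Fin 3) ℝ)ᵀ * (S : Matrix (Fin 3) (Fin 3) ℝ))) := by
  rw [localRep_eq_smul_axialVec, real_inner_smul_right]
  exact mul_nonneg (localRep_coeff_nonneg hk hgk hr) (SO3.inner_axialVec_nonneg hP hQ hS h)

lemma inner_axialVec_controlLaw (A : Matrix (Fin 3) (Fin 3) ℝ) (N : Fin n → Finset (Fin n))
    (R : Fin n → SO3) (i : Fin n) :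
    inner ℝ (axialVec A) (controlLaw a g N R i) = ∑ j ∈ N i, a i j * inner ℝ (axialVec A)
      (localRep g ((R i : Matrix (Fin 3) (Fin 3) ℝ)ᵀ * (R j : Matrix (Fin 3) (Fin 3) ℝ))) := by
  rw [controlLaw, inner_sum]
  simp_rw [real_inner_smul_right]

/-- The target `Q` need not be an agent: `Q = 1` serves forward invariance, `Q = R j` the decay of
relative distances. -/
lemma inner_axialVec_controlLaw_nonneg (hk : 0 < k) (hgk : ∀ θ ∈ Ico 0 r, k * θ ≤ g θ)
    (ha : ∀ i j, 0 < a i j) {q : ℝ} (hq0 : 0 ≤ q) (hqr : 2 * q < r) (hr : r ≤ Real.pi)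
    (N : Fin n → Finset (Fin n)) {R : Fin n → SO3} (hR : R ∈ closedRotBallPow n q) (i : Fin n)
    {Q : SO3} (hQ : 1 < (Q : Matrix (Fin 3) (Fin 3) ℝ).trace)
    (h : ∀ j, ((R i : Matrix (Fin 3) (Fin 3) ℝ)ᵀ * (Q : Matrix (Fin 3) (Fin 3) ℝ)).trace ≤
      ((Q : Matrix (Fin 3) (Fin 3) ℝ)ᵀ * (R j : Matrix (Fin 3) (Fin 3) ℝ)).trace) :
    0 ≤ inner ℝ (axialVec ((R i : Matrix (Fin 3) (Fin 3) ℝ)ᵀ * (Q : Matrix (Fin 3) (Fin 3) ℝ)))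
      (controlLaw a g N R i) := by
  have hq : q < Real.pi / 2 := by linarith
  rw [inner_axialVec_controlLaw]
  refine Finset.sum_nonneg fun j _ => mul_nonneg (ha i j).le ?_
  exact inner_axialVec_localRep_nonneg hk hgk (one_lt_trace_of_mem_closedRotBallPow hq0 hq hR i) hQ
    (one_lt_trace_of_mem_closedRotBallPow hq0 hq hR j) (h j)
    ((rotAngle_relative_le hq0 hq hR i j).trans_lt hqr)

/-- All summands are nonnegative, so the one of the edge suffices. It contains `(3 - τ)(1 + τ)`,
where `1 + τ ≥ 4 cos² q` inside the ball. -/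
lemma le_inner_axialVec_controlLaw (hk : 0 < k) (hgk : ∀ θ ∈ Ico 0 r, k * θ ≤ g θ)
    (ha : ∀ i j, 0 < a i j) {q : ℝ} (hq0 : 0 ≤ q) (hqr : 2 * q < r) (hr : r ≤ Real.pi)
    (N : Fin n → Finset (Fin n)) {R : Fin n → SO3} (hR : R ∈ closedRotBallPow n q) {i j : Fin n}
    (hij : j ∈ N i)
    (h : ∀ l, ((R i : Matrix (Fin 3) (Fin 3) ℝ)ᵀ * (R j : Matrix (Fin 3) (Fin 3) ℝ)).trace ≤
      ((R j : Matrix (Fin 3) (Fin 3) ℝ)ᵀ * (R l : Matrix (Fin 3) (Fin 3) ℝ)).trace)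
    {α : ℝ} (hα : α ≤ a i j) :
    2 * (α * k * Real.cos q ^ 2) *
        (3 - ((R i : Matrix (Fin 3) (Fin 3) ℝ)ᵀ * (R j : Matrix (Fin 3) (Fin 3) ℝ)).trace) ≤
      inner ℝ (axialVec ((R i : Matrix (Fin 3) (Fin 3) ℝ)ᵀ * (R j : Matrix (Fin 3) (Fin 3) ℝ)))
        (controlLaw a g N R i) := by
  have hq : q < Real.pi / 2 := by linarith
  have h1 := one_lt_trace_of_mem_closedRotBallPow hq0 hq hR
  have hcos := Real.cos_pos_of_mem_Ioo (x := q) ⟨by linarith, hq⟩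
  have htr := trace_relative_ge hq0 hq hR i j
  rw [inner_axialVec_controlLaw]
  refine le_trans ?_ (Finset.single_le_sum (fun l _ => mul_nonneg (ha i l).le
    (inner_axialVec_localRep_nonneg hk hgk (h1 i) (h1 j) (h1 l) (h l)
    ((rotAngle_relative_le hq0 hq hR i l).trans_lt hqr))) hij)
  have h2 := le_inner_axialVec_localRep (g := g) (R := (R i)⁻¹ * R j) hk hgk
    (by rw [SO3.coe_transpose_mul]; nlinarith)
    (by rw [SO3.coe_transpose_mul]; exact (rotAngle_relative_le hq0 hq hR i j).trans_lt hqr)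
  have h3 := ((R i)⁻¹ * R j).trace_le_three
  rw [SO3.coe_transpose_mul] at h2 h3
  set τ := ((R i : Matrix (Fin 3) (Fin 3) ℝ)ᵀ * (R j : Matrix (Fin 3) (Fin 3) ℝ)).trace
  have h4 : k / 2 * ((3 - τ) * (4 * Real.cos q ^ 2)) ≤ k / 2 * ((3 - τ) * (1 + τ)) := by
    gcongr
    linarith
  have h5 : 0 ≤ k / 2 * ((3 - τ) * (4 * Real.cos q ^ 2)) :=
    mul_nonneg (by positivity) (mul_nonneg (by linarith) (by positivity))
  calc _ = α * (k / 2 * ((3 - τ) * (4 * Real.cos q ^ 2))) := by ring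
    _ ≤ a i j * (k / 2 * ((3 - τ) * (4 * Real.cos q ^ 2))) := by gcongr
    _ ≤ _ := mul_le_mul_of_nonneg_left (h4.trans h2) (ha i j).le

lemma continuous_trace_relative (i j : Fin n) : Continuous (fun R : Fin n → SO3 =>
    ((R i : Matrix (Fin 3) (Fin 3) ℝ)ᵀ * (R j : Matrix (Fin 3) (Fin 3) ℝ)).trace) := by
  fun_prop

lemma continuous_trace_apply (i : Fin n) : Continuous (fun R : Fin n → SO3 =>
    (R i : Matrix (Fin 3) (Fin 3) ℝ).trace) := by
  fun_prop

/-- Forward invariance of the ball, for curves that satisfy the closed loop equation only as long as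
they are in a larger ball. -/
lemma mem_closedRotBallPow_of_solution (hk : 0 < k) (hgk : ∀ θ ∈ Ico 0 r, k * θ ≤ g θ)
    (ha : ∀ i j, 0 < a i j) {q q' : ℝ} (hq0 : 0 ≤ q) (hqq' : q < q') (hqr : 2 * q' < r)
    (hr : r ≤ Real.pi) {N : ℝ → Fin n → Finset (Fin n)} {R : ℝ → Fin n → SO3} {t₀ T : ℝ}
    (hcont : ContinuousOn R (Icc t₀ T)) (h0 : R t₀ ∈ closedRotBallPow n q)
    (hderiv : ∀ t ∈ Ico t₀ T, R t ∈ closedRotBallPow n q' → ∀ i,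
      HasDerivWithinAt (fun s => (R s i : Matrix (Fin 3) (Fin 3) ℝ))
        ((R t i : Matrix (Fin 3) (Fin 3) ℝ) * hat (controlLaw a g (N t) (R t) i)) (Ici t) t) :
    ∀ t ∈ Icc t₀ T, R t ∈ closedRotBallPow n q := by
  intro t ht
  have hcos : Real.cos q' < Real.cos q :=
    Real.cos_lt_cos_of_nonneg_of_le_pi hq0 (by linarith [Real.pi_pos]) hqq'
  have hq'0 : 0 ≤ q' := by linarith
  have hq'π : q' < Real.pi / 2 := by linarith
  rw [mem_closedRotBallPow_iff hq0 (by linarith)] at h0 ⊢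
  -- The derivative of the trace is only known to be nonnegative, so the barrier is relaxed linearly
  -- in time to make the inequality strict. The bound on `ε` keeps the relaxed barrier inside the
  -- ball of radius `q'`, where the equation is available.
  have key : ∀ ε > 0, ε * (T - t₀) ≤ 2 * Real.cos q - 2 * Real.cos q' → ∀ i,
      1 + 2 * Real.cos q - (R t i : Matrix (Fin 3) (Fin 3) ℝ).trace - ε * (t - t₀) ≤ 0 := by
    intro ε hε hεT
    refine nonpos_of_right_deriv_neg (h := fun i s =>
      1 + 2 * Real.cos q - (R s i : Matrix (Fin 3) (Fin 3) ℝ).trace - ε * (s - t₀))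
      (fun i => ?_) (fun i => by simpa using h0 i) ?_ t ht
    · exact (continuousOn_const.sub ((continuous_trace_apply i).comp_continuousOn hcont)).sub
        (by fun_prop)
    · intro i s hs hi hj
      have hsT : ε * (s - t₀) ≤ ε * (T - t₀) := by gcongr; exact hs.2.le
      have hmem : R s ∈ closedRotBallPow n q' := by
        rw [mem_closedRotBallPow_iff hq'0 (by linarith)]
        intro j
        linarith [hj j]
      have hd := hasDerivWithinAt_trace_relative (G := fun _ => 1) (p' := 0) (hderiv s hs hmem i)
        (by
          rw [hat_zero, mul_zero]
          exact hasDerivWithinAt_const s (Ici s) (1 : Matrix (Fin 3) (Fin 3) ℝ))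
      have hnn := inner_axialVec_controlLaw_nonneg hk hgk ha hq'0 hqr hr (N s) hmem i (Q := 1)
        (by simp [Matrix.trace_one]) (fun j => by
          simp only [OneMemClass.coe_one, mul_one, Matrix.transpose_one, one_mul,
            Matrix.trace_transpose]
          linarith [hj j])
      simp only [OneMemClass.coe_one, mul_one, Matrix.trace_transpose, inner_zero_right,
        add_zero] at hd hnn
      refine ⟨_, ?_, (hd.const_sub (1 + 2 * Real.cos q)).sub
        (((hasDerivWithinAt_id s (Ici s)).sub_const t₀).const_mul ε)⟩
      linarith
  intro i
  by_contra hlt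
  push Not at hlt
  rcases ht.1.eq_or_lt with rfl | ht0
  · exact absurd (h0 i) (by linarith)
  set δ := 1 + 2 * Real.cos q - (R t i : Matrix (Fin 3) (Fin 3) ℝ).trace with hδ
  have hT : 0 < T - t₀ := by linarith [ht.2]
  have hδ0 : 0 < δ := by linarith
  -- The total relaxation over `[t₀, T]` is at most `δ / 2`, too little to account for the excess
  -- `δ`.
  have hm : 0 < min (δ / 2) (2 * Real.cos q - 2 * Real.cos q') :=
    lt_min (by linarith) (by linarith)
  have := key (min (δ / 2) (2 * Real.cos q - 2 * Real.cos q') / (T - t₀)) (by positivity)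
    (by rw [div_mul_cancel₀ _ hT.ne']; exact min_le_right _ _) i
  have h1 : min (δ / 2) (2 * Real.cos q - 2 * Real.cos q') / (T - t₀) * (t - t₀) ≤
      min (δ / 2) (2 * Real.cos q - 2 * Real.cos q') / (T - t₀) * (T - t₀) := by
    gcongr
    exact ht.2
  rw [div_mul_cancel₀ _ hT.ne'] at h1
  linarith [min_le_left (δ / 2) (2 * Real.cos q - 2 * Real.cos q')]

/-- Exponential decay of all relative squared chordal distances. -/
lemma three_sub_trace_le_of_solution (hk : 0 < k) (hgk : ∀ θ ∈ Ico 0 r, k * θ ≤ g θ)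
    {α : ℝ} (hα0 : 0 < α) (hα : ∀ i j, α ≤ a i j) {q : ℝ} (hq0 : 0 ≤ q) (hqr : 2 * q < r)
    (hr : r ≤ Real.pi) {N : ℝ → Fin n → Finset (Fin n)}
    (hedge : ∀ t i j, j ∈ N t i ∨ i ∈ N t j) {R : ℝ → Fin n → SO3} {t₀ T : ℝ}
    (hcont : ContinuousOn R (Icc t₀ T)) (hmem : ∀ t ∈ Icc t₀ T, R t ∈ closedRotBallPow n q)
    (hderiv : ∀ t ∈ Ico t₀ T, ∀ i,
      HasDerivWithinAt (fun s => (R s i : Matrix (Fin 3) (Fin 3) ℝ))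
        ((R t i : Matrix (Fin 3) (Fin 3) ℝ) * hat (controlLaw a g (N t) (R t) i)) (Ici t) t)
    {V : ℝ} (hV0 : 0 ≤ V) (hV : ∀ i j, 3 - ((R t₀ i : Matrix (Fin 3) (Fin 3) ℝ)ᵀ *
      (R t₀ j : Matrix (Fin 3) (Fin 3) ℝ)).trace ≤ V) :
    ∀ t ∈ Icc t₀ T, ∀ i j, 3 - ((R t i : Matrix (Fin 3) (Fin 3) ℝ)ᵀ *
      (R t j : Matrix (Fin 3) (Fin 3) ℝ)).trace ≤
        V * Real.exp (-(α * k * Real.cos q ^ 2) * (t - t₀)) := by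
  intro t ht i j
  have hq : q < Real.pi / 2 := by linarith
  have hcos := Real.cos_pos_of_mem_Ioo (x := q) ⟨by linarith, hq⟩
  have ha : ∀ i j, 0 < a i j := fun i j => hα0.trans_le (hα i j)
  set ρ := α * k * Real.cos q ^ 2 with hρ
  have hρ0 : 0 < ρ := by positivity
  -- The extra `ε` keeps the barrier positive even if `V = 0`, so that it decreases strictly.
  refine le_of_forall_pos_le_add fun ε hε => ?_
  have key := nonpos_of_right_deriv_neg (a := t₀) (b := T) (h := fun (p : Fin n × Fin n) s =>
      3 - ((R s p.1 : Matrix (Fin 3) (Fin 3) ℝ)ᵀ * (R s p.2 : Matrix (Fin 3) (Fin 3) ℝ)).trace -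
        (V + ε) * Real.exp (-ρ * (s - t₀)))
      (fun p => ?_) (fun p => ?_) ?_ t ht (i, j)
  · have h1 : Real.exp (-ρ * (t - t₀)) ≤ 1 :=
      Real.exp_le_one_iff.2 (by nlinarith [ht.1])
    have h2 := mul_le_mul_of_nonneg_left h1 hε.le
    simp only at key
    linarith
  · exact (continuousOn_const.sub ((continuous_trace_relative _ _).comp_continuousOn hcont)).sub
        (by fun_prop)
  · have := hV p.1 p.2
    simp only [sub_self, mul_zero, Real.exp_zero, mul_one]
    linarith
  · rintro ⟨i, j⟩ s hs hi hj
    have hm := hmem s ⟨hs.1, hs.2.le⟩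
    have hd := hasDerivWithinAt_trace_relative (hderiv s hs i) (hderiv s hs j)
    have h1 := one_lt_trace_of_mem_closedRotBallPow hq0 hq hm
    simp only [Prod.forall] at hi hj
    have hpos : 0 < (V + ε) * Real.exp (-ρ * (s - t₀)) := by positivity
    have hcomm := trace_transpose_mul_comm (R s i : Matrix (Fin 3) (Fin 3) ℝ) (R s j)
    have hij : ∀ l, ((R s i : Matrix (Fin 3) (Fin 3) ℝ)ᵀ *
        (R s j : Matrix (Fin 3) (Fin 3) ℝ)).trace ≤ ((R s j : Matrix (Fin 3) (Fin 3) ℝ)ᵀ *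
        (R s l : Matrix (Fin 3) (Fin 3) ℝ)).trace := fun l => by linarith [hj j l]
    have hji : ∀ l, ((R s j : Matrix (Fin 3) (Fin 3) ℝ)ᵀ *
        (R s i : Matrix (Fin 3) (Fin 3) ℝ)).trace ≤ ((R s i : Matrix (Fin 3) (Fin 3) ℝ)ᵀ *
        (R s l : Matrix (Fin 3) (Fin 3) ℝ)).trace := fun l => by linarith [hj i l]
    have n1 := inner_axialVec_controlLaw_nonneg hk hgk ha hq0 hqr hr (N s) hm i (h1 j) hij
    have n2 := inner_axialVec_controlLaw_nonneg hk hgk ha hq0 hqr hr (N s) hm j (h1 i) hji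
    -- A pair touching the barrier contracts at rate `2ρ`, while the barrier decays at rate `ρ`; the
    -- gap gives the strict sign.
    have hlow : 2 * ρ * ((V + ε) * Real.exp (-ρ * (s - t₀))) ≤
        inner ℝ (axialVec ((R s i : Matrix (Fin 3) (Fin 3) ℝ)ᵀ *
          (R s j : Matrix (Fin 3) (Fin 3) ℝ))) (controlLaw a g (N s) (R s) i) +
        inner ℝ (axialVec ((R s j : Matrix (Fin 3) (Fin 3) ℝ)ᵀ *
          (R s i : Matrix (Fin 3) (Fin 3) ℝ))) (controlLaw a g (N s) (R s) j) := by
      have e : (V + ε) * Real.exp (-ρ * (s - t₀)) = 3 - ((R s i : Matrix (Fin 3) (Fin 3) ℝ)ᵀ *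
          (R s j : Matrix (Fin 3) (Fin 3) ℝ)).trace := by linarith
      rcases hedge s i j with h | h
      · have := le_inner_axialVec_controlLaw hk hgk ha hq0 hqr hr (N s) hm h hij (hα i j)
        rw [e]
        linarith
      · have := le_inner_axialVec_controlLaw hk hgk ha hq0 hqr hr (N s) hm h hji (hα j i)
        rw [e, hcomm]
        linarith
    have hexp : HasDerivWithinAt (fun u => (V + ε) * Real.exp (-ρ * (u - t₀)))
        ((V + ε) * (Real.exp (-ρ * (s - t₀)) * (-ρ * 1))) (Ici s) s :=
      ((((hasDerivWithinAt_id s (Ici s)).sub_const t₀).const_mul (-ρ)).exp).const_mul _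
    refine ⟨_, ?_, (hd.const_sub 3).sub hexp⟩
    nlinarith

end ControlLaw

/-! ### Lipschitz vector fields and a uniform existence time -/

lemma LocallyLipschitz.pi {ι α : Type*} {β : ι → Type*} [Fintype ι] [PseudoEMetricSpace α]
    [∀ i, PseudoEMetricSpace (β i)] {f : α → ∀ i, β i}
    (hf : ∀ i, LocallyLipschitz (fun x => f x i)) : LocallyLipschitz f := by
  intro x
  choose K t ht hK using fun i => hf i x
  refine ⟨Finset.univ.sup K, ⋂ i, t i, Filter.iInter_mem.2 ht, fun y hy z hz => ?_⟩
  rw [edist_pi_le_iff]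
  intro i
  refine (hK i (mem_iInter.1 hy i) (mem_iInter.1 hz i)).trans ?_
  gcongr
  exact Finset.le_sup (Finset.mem_univ i)

lemma SmoothOnSubset.locallyLipschitzOn {E F : Type*} [NormedAddCommGroup E] [NormedSpace ℝ E]
    [NormedAddCommGroup F] [NormedSpace ℝ F] {f : E → F} {X : Set E} (hf : SmoothOnSubset f X) :
    LocallyLipschitzOn X f := by
  intro x hx
  obtain ⟨U, hU, hxU, f', hf', heq⟩ := hf x hx
  have h1 : ContDiffAt ℝ 1 f' x := ((hf' x hxU).contDiffAt (hU.mem_nhds hxU)).of_le (by simp)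
  obtain ⟨K, t, ht, hK⟩ := h1.exists_lipschitzOnWith
  refine ⟨K, X ∩ (U ∩ t), Filter.inter_mem self_mem_nhdsWithin
    (mem_nhdsWithin_of_mem_nhds (Filter.inter_mem (hU.mem_nhds hxU) ht)), fun y hy z hz => ?_⟩
  rw [heq ⟨hy.1, hy.2.1⟩, heq ⟨hz.1, hz.2.1⟩]
  exact hK hy.2.2 hz.2.2

/-- A finite family of locally Lipschitz maps has a common Lipschitz constant on a compact set. -/
lemma exists_common_lipschitzOnWith {ι E F : Type*} [Fintype ι] [PseudoMetricSpace E]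
    [PseudoMetricSpace F] {v : ι → E → F} (hv : ∀ i, LocallyLipschitz (v i)) {s : Set E}
    (hs : IsCompact s) : ∃ K, ∀ i, LipschitzOnWith K (v i) s := by
  choose K hK using fun i =>
    ((hv i).locallyLipschitzOn (s := s)).exists_lipschitzOnWith_of_compact hs
  exact ⟨Finset.univ.sup K, fun i => (hK i).weaken (Finset.le_sup (Finset.mem_univ i))⟩

/-- For a finite family of locally Lipschitz vector fields, integral curves starting in a bounded
set exist on intervals of a common length. -/
lemma exists_uniform_integralCurve {ι E : Type*} [Fintype ι] [NormedAddCommGroup E]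
    [NormedSpace ℝ E] [FiniteDimensional ℝ E] {v : ι → E → E}
    (hv : ∀ i, LocallyLipschitz (v i)) {s : Set E} (hs : Bornology.IsBounded s) :
    ∃ ε > 0, ∀ i, ∀ x ∈ s, ∀ t₀ : ℝ, ∃ γ : ℝ → E, γ t₀ = x ∧
      ContinuousOn γ (Icc t₀ (t₀ + ε)) ∧
      ∀ t ∈ Ico t₀ (t₀ + ε), HasDerivWithinAt γ (v i (γ t)) (Ici t) t := by
  have : ProperSpace E := FiniteDimensional.proper ℝ E
  have : CompleteSpace E := FiniteDimensional.complete ℝ E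
  obtain ⟨ρ, hρ⟩ := hs.subset_closedBall 0
  have hB : IsCompact (Metric.closedBall (0 : E) (ρ + 1)) := isCompact_closedBall _ _
  obtain ⟨K, hK⟩ := exists_common_lipschitzOnWith hv hB
  choose C hC using fun i => hB.exists_bound_of_continuousOn (hv i).continuous.continuousOn
  set L : NNReal := Finset.univ.sup fun i => (C i).toNNReal with hL
  have hLC : ∀ i, C i ≤ L := fun i => (Real.le_coe_toNNReal _).trans
    (NNReal.coe_le_coe.2 (Finset.le_sup (f := fun i => (C i).toNNReal) (Finset.mem_univ i)))
  -- A curve of speed at most `L` cannot leave the unit ball around its start within this time, and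
  -- all those unit balls lie in one compact ball.
  refine ⟨1 / (L + 1), by positivity, fun i x hx t₀ => ?_⟩
  have hε : 0 < 1 / ((L : ℝ) + 1) := by positivity
  have hsub : Metric.closedBall x ((1 : NNReal) : ℝ) ⊆ Metric.closedBall 0 (ρ + 1) := by
    refine Metric.closedBall_subset_closedBall' ?_
    have : dist x 0 ≤ ρ := hρ hx
    simp only [NNReal.coe_one]
    linarith
  have hpl : IsPicardLindelof (fun _ => v i) (tmin := t₀) (tmax := t₀ + 1 / (L + 1))
      ⟨t₀, left_mem_Icc.2 (by linarith)⟩ x 1 0 L K := by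
    refine IsPicardLindelof.of_time_independent (fun y hy => (hC i y (hsub hy)).trans (hLC i))
      ((hK i).mono hsub) ?_
    simp only [add_sub_cancel_left, sub_self, NNReal.coe_one, NNReal.coe_zero, sub_zero]
    rw [max_eq_left hε.le, mul_one_div, div_le_one (by positivity)]
    linarith
  obtain ⟨γ, h0, hγ⟩ := hpl.exists_eq_forall_mem_Icc_hasDerivWithinAt₀
  refine ⟨γ, h0, fun t ht => (hγ t ht).continuousWithinAt, fun t ht => ?_⟩
  exact (hγ t ⟨ht.1, ht.2.le⟩).mono_of_mem_nhdsWithin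
    (mem_of_superset (Icc_mem_nhdsGE ht.2) (Icc_subset_Icc_left ht.1))

/-! ### Matrix curves that remain in `SO(3)` -/

lemma ContinuousOn.matrix_mul_three {F G : ℝ → Matrix (Fin 3) (Fin 3) ℝ} {s : Set ℝ}
    (hF : ContinuousOn F s) (hG : ContinuousOn G s) : ContinuousOn (fun t => F t * G t) s := by
  rw [continuousOn_iff_continuous_domRestrict] at *
  exact hF.matrix_mul hG

lemma ContinuousOn.trace_mul {F G : ℝ → Matrix (Fin 3) (Fin 3) ℝ} {s : Set ℝ}
    (hF : ContinuousOn F s) (hG : ContinuousOn G s) : ContinuousOn (fun t => (F t * G t).trace) s :=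
  Continuous.comp_continuousOn (g := Matrix.trace) (by fun_prop) (hF.matrix_mul_three hG)

/-- The squared Frobenius norm of `G - 1` is `tr (GᵀG) - 2 tr G + 3 = 0`. Thus two scalar conserved
quantities suffice to preserve orthogonality. -/
lemma Matrix.eq_one_of_trace_eq {G : Matrix (Fin 3) (Fin 3) ℝ} (hG : Gᵀ = G)
    (h1 : G.trace = 3) (h2 : (Gᵀ * G).trace = 3) : G = 1 := by
  have h : ((G - 1)ᵀ * (G - 1)).trace = 0 := by
    have : (G - 1)ᵀ * (G - 1) = Gᵀ * G - G - G + 1 := by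
      rw [Matrix.transpose_sub, Matrix.transpose_one, hG]
      noncomm_ring
    rw [this, Matrix.trace_add, Matrix.trace_sub, Matrix.trace_sub, h1, h2]
    norm_num [Matrix.trace_one]
  have := (Matrix.trace_conjTranspose_mul_self_eq_zero_iff (A := G - 1)).1 (by simpa using h)
  exact sub_eq_zero.1 this

/-- A curve with skew-symmetric body velocity that starts in `SO(3)` stays in `SO(3)`. -/
lemma mem_SO3_of_hasDerivWithinAt {X : ℝ → Matrix (Fin 3) (Fin 3) ℝ} {p : ℝ → E3} {b c : ℝ}
    (hcont : ContinuousOn X (Icc b c)) (h0 : X b ∈ Matrix.specialOrthogonalGroup (Fin 3) ℝ)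
    (hX : ∀ t ∈ Ico b c, HasDerivWithinAt X (X t * hat (p t)) (Ici t) t) :
    ∀ t ∈ Icc b c, X t ∈ Matrix.specialOrthogonalGroup (Fin 3) ℝ := by
  have h0' := (mem_SO3_iff _).1 h0
  have hcT : ContinuousOn (fun t => (X t)ᵀ) (Icc b c) :=
    Continuous.comp_continuousOn (g := Matrix.transpose) (by fun_prop) hcont
  -- The Gram matrix `G = XᵀX` satisfies the Lax equation `G' = [G, hat p]`, so the traces of `G`
  -- and `G²` are constant.
  have hG : ∀ t ∈ Ico b c, HasDerivWithinAt (fun u => (X u)ᵀ * X u)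
      ((X t)ᵀ * X t * hat (p t) - hat (p t) * ((X t)ᵀ * X t)) (Ici t) t := by
    intro t ht
    refine ((hX t ht).transpose_mul (hX t ht)).congr_deriv ?_
    rw [Matrix.transpose_mul, hat_transpose]
    noncomm_ring
  have hGc : ContinuousOn (fun t => (X t)ᵀ * X t) (Icc b c) := hcT.matrix_mul_three hcont
  have hGs : ∀ t, ((X t)ᵀ * X t)ᵀ = (X t)ᵀ * X t := fun t => by
    rw [Matrix.transpose_mul, Matrix.transpose_transpose]
  have htr1 : ∀ t ∈ Icc b c, ((X t)ᵀ * X t).trace = ((X b)ᵀ * X b).trace := by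
    refine constant_of_has_deriv_right_zero (hcT.trace_mul hcont) fun t ht => ?_
    refine ((hX t ht).trace_transpose_mul (hX t ht)).congr_deriv ?_
    rw [Matrix.transpose_mul, hat_transpose, neg_mul, neg_mul, Matrix.trace_neg, Matrix.mul_assoc,
      Matrix.trace_mul_comm, Matrix.mul_assoc]
    ring
  have htr2 : ∀ t ∈ Icc b c, (((X t)ᵀ * X t)ᵀ * ((X t)ᵀ * X t)).trace =
      (((X b)ᵀ * X b)ᵀ * ((X b)ᵀ * X b)).trace := by
    refine constant_of_has_deriv_right_zero (f := fun t =>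
      (((X t)ᵀ * X t)ᵀ * ((X t)ᵀ * X t)).trace) ?_ fun t ht => ?_
    · simp_rw [hGs]
      exact hGc.trace_mul hGc
    · refine ((hG t ht).trace_transpose_mul (hG t ht)).congr_deriv ?_
      have hs := hGs t
      generalize (X t)ᵀ * X t = G at hs ⊢
      rw [Matrix.transpose_sub, Matrix.transpose_mul, Matrix.transpose_mul, hat_transpose, hs,
        ← Matrix.trace_add]
      have : (-hat (p t) * G - G * -hat (p t)) * G + G * (G * hat (p t) - hat (p t) * G) =
          G * G * hat (p t) - hat (p t) * (G * G) := by noncomm_ring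
      rw [this, Matrix.trace_sub, Matrix.trace_mul_comm, sub_self]
  have hortho : ∀ t ∈ Icc b c, (X t)ᵀ * X t = 1 := fun t ht =>
    Matrix.eq_one_of_trace_eq (hGs t) (by rw [htr1 t ht, h0'.1]; simp [Matrix.trace_one])
      (by rw [htr2 t ht, h0'.1]; simp [Matrix.trace_one])
  intro t ht
  refine (mem_SO3_iff _).2 ⟨hortho t ht, ?_⟩
  have hdet : ∀ u ∈ Icc b c, (X u).det * (X u).det = 1 := fun u hu => by
    have := congrArg Matrix.det (hortho u hu)
    simpa using this
  have hdc : ContinuousOn (fun u => (X u).det) (Icc b t) :=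
    Continuous.comp_continuousOn (g := Matrix.det) (by fun_prop)
      (hcont.mono (Icc_subset_Icc_right ht.2))
  -- The determinant is `±1` and continuous; a value `-1` would force a zero in between.
  rcases mul_self_eq_one_iff.1 (hdet t ht) with h | h
  · exact h
  · obtain ⟨u, hu, hu0⟩ := intermediate_value_Icc' ht.1 hdc
      (show (0 : ℝ) ∈ Icc (X t).det (X b).det by rw [h, h0'.2]; constructor <;> norm_num)
    have := hdet u ⟨hu.1, hu.2.trans ht.2⟩
    simp only at hu0
    rw [hu0] at this
    norm_num at this

/-! ### Regularity of the closed loop vector field -/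

lemma contDiff_matrix {E : Type*} [NormedAddCommGroup E] [NormedSpace ℝ E] {m : WithTop ℕ∞}
    {F : E → Matrix (Fin 3) (Fin 3) ℝ} (h : ∀ i j, ContDiff ℝ m (fun x => F x i j)) :
    ContDiff ℝ m F := by
  let e : (Fin 3 → Fin 3 → ℝ) ≃L[ℝ] Matrix (Fin 3) (Fin 3) ℝ :=
    (Matrix.ofLinearEquiv ℝ).toContinuousLinearEquiv
  exact e.contDiff.comp (contDiff_pi.2 fun i => contDiff_pi.2 fun j => h i j)

lemma contDiff_matrix_entry {m : WithTop ℕ∞} (i j : Fin 3) :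
    ContDiff ℝ m (fun M : Matrix (Fin 3) (Fin 3) ℝ => M i j) :=
  (LinearMap.toContinuousLinearMap (Matrix.entryLinearMap ℝ ℝ i j)).contDiff

lemma ContDiff.matrix_mul_three {E : Type*} [NormedAddCommGroup E] [NormedSpace ℝ E]
    {m : WithTop ℕ∞} {F G : E → Matrix (Fin 3) (Fin 3) ℝ} (hF : ContDiff ℝ m F)
    (hG : ContDiff ℝ m G) : ContDiff ℝ m (fun x => F x * G x) := by
  refine contDiff_matrix fun i j => ?_
  simp only [Matrix.mul_apply]
  exact ContDiff.sum fun l _ =>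
    ((contDiff_matrix_entry i l).comp hF).mul ((contDiff_matrix_entry l j).comp hG)

lemma ContDiff.matrix_transpose_three {E : Type*} [NormedAddCommGroup E] [NormedSpace ℝ E]
    {m : WithTop ℕ∞} {F : E → Matrix (Fin 3) (Fin 3) ℝ} (hF : ContDiff ℝ m F) :
    ContDiff ℝ m (fun x => (F x)ᵀ) :=
  contDiff_matrix fun i j => (contDiff_matrix_entry j i).comp hF

lemma contDiff_hat {m : WithTop ℕ∞} : ContDiff ℝ m hat := by
  refine contDiff_matrix fun i j => ?_
  fin_cases i <;> fin_cases j <;> simp [hat] <;> fun_prop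

/-- The closed loop vector field with the local representation replaced by a map `φ`. -/
noncomputable def closedLoopField {n : ℕ} (a : Fin n → Fin n → ℝ)
    (φ : Matrix (Fin 3) (Fin 3) ℝ → E3) (N : Fin n → Finset (Fin n))
    (X : Fin n → Matrix (Fin 3) (Fin 3) ℝ) (i : Fin n) : Matrix (Fin 3) (Fin 3) ℝ :=
  X i * hat (∑ j ∈ N i, a i j • φ ((X i)ᵀ * X j))

lemma locallyLipschitz_closedLoopField {n : ℕ} (a : Fin n → Fin n → ℝ)
    {φ : Matrix (Fin 3) (Fin 3) ℝ → E3} (hφ : LocallyLipschitz φ) (N : Fin n → Finset (Fin n)) :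
    LocallyLipschitz (closedLoopField a φ N) := by
  -- Since `φ` is merely Lipschitz, the field is split into a smooth map of the pair (state, values
  -- of `φ`) and the locally Lipschitz map producing that pair.
  have hΨ : ContDiff ℝ 1 (fun (p : (Fin n → Matrix (Fin 3) (Fin 3) ℝ) × (Fin n → Fin n → E3))
      (i : Fin n) => p.1 i * hat (∑ j ∈ N i, a i j • p.2 i j)) := by
    refine contDiff_pi.2 fun i => ContDiff.matrix_mul_three ?_ (contDiff_hat.comp ?_)
    · exact (contDiff_apply ℝ _ i).comp contDiff_fst
    · refine ContDiff.sum fun j _ => ?_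
      have h : ContDiff ℝ 1 (fun p : (Fin n → Matrix (Fin 3) (Fin 3) ℝ) × (Fin n → Fin n → E3) =>
        p.2 i j) := (contDiff_apply_apply ℝ E3 i j).comp contDiff_snd
      exact h.const_smul (a i j)
  have hrel : ∀ i j : Fin n, LocallyLipschitz
      (fun X : Fin n → Matrix (Fin 3) (Fin 3) ℝ => (X i)ᵀ * X j) := fun i j =>
    (((contDiff_apply ℝ _ i).matrix_transpose_three).matrix_mul_three
      (contDiff_apply ℝ _ j)).locallyLipschitz
  have hrel' : LocallyLipschitz (fun (X : Fin n → Matrix (Fin 3) (Fin 3) ℝ) (i j : Fin n) =>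
      φ ((X i)ᵀ * X j)) := by
    refine LocallyLipschitz.pi fun i => LocallyLipschitz.pi fun j => ?_
    exact hφ.comp (hrel i j)
  have hcomp := hΨ.locallyLipschitz.comp (LocallyLipschitz.id.prodMk hrel')
  change LocallyLipschitz ((fun (p : (Fin n → Matrix (Fin 3) (Fin 3) ℝ) × (Fin n → Fin n → E3))
    (i : Fin n) => p.1 i * hat (∑ j ∈ N i, a i j • p.2 i j)) ∘
      fun X : Fin n → Matrix (Fin 3) (Fin 3) ℝ => (X, fun i j => φ ((X i)ᵀ * X j)))
  exact hcomp

lemma Matrix.frobenius_norm_sq_eq_trace (M : Matrix (Fin 3) (Fin 3) ℝ) :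
    ‖M‖ ^ 2 = (Mᵀ * M).trace := by
  rw [Matrix.frobenius_norm_def, ← Real.sqrt_eq_rpow, Real.sq_sqrt (by positivity),
    Finset.sum_comm]
  simp [Matrix.trace, Matrix.mul_apply, sq]

lemma SO3.norm_le_two (R : SO3) : ‖(R : Matrix (Fin 3) (Fin 3) ℝ)‖ ≤ 2 := by
  have h := Matrix.frobenius_norm_sq_eq_trace (R : Matrix (Fin 3) (Fin 3) ℝ)
  rw [R.transpose_mul_self, Matrix.trace_one, Fintype.card_fin] at h
  push_cast at h
  nlinarith [norm_nonneg (R : Matrix (Fin 3) (Fin 3) ℝ)]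

lemma continuous_rotAngle : Continuous rotAngle := by
  unfold rotAngle
  fun_prop

lemma isCompact_rotAngle_le (ρ : ℝ) : IsCompact {M : Matrix (Fin 3) (Fin 3) ℝ |
    M ∈ Matrix.specialOrthogonalGroup (Fin 3) ℝ ∧ rotAngle M ≤ ρ} := by
  have : ProperSpace (Matrix (Fin 3) (Fin 3) ℝ) := FiniteDimensional.proper ℝ _
  refine (isCompact_closedBall (0 : Matrix (Fin 3) (Fin 3) ℝ) 2).of_isClosed_subset ?_ ?_
  · simp only [mem_SO3_iff]
    refine IsClosed.and (IsClosed.and ?_ ?_) ?_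
    · exact isClosed_eq (f := fun M : Matrix (Fin 3) (Fin 3) ℝ => Mᵀ * M) (by fun_prop) (by fun_prop)
    · exact isClosed_eq (f := Matrix.det) (by fun_prop) (by fun_prop)
    · exact isClosed_le continuous_rotAngle continuous_const
  · rintro M ⟨hM, -⟩
    rw [mem_closedBall_zero_iff]
    exact SO3.norm_le_two ⟨M, hM⟩

/-- The local representation agrees with a globally Lipschitz map on smaller closed balls. -/
lemma IsLocalRepresentation.exists_lipschitzWith_extension {r : ℝ} {g : ℝ → ℝ}
    (hg : IsLocalRepresentation r g) {ρ : ℝ} (hρ : ρ < r) :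
    ∃ φ : Matrix (Fin 3) (Fin 3) ℝ → E3, LocallyLipschitz φ ∧
      ∀ R : SO3, rotAngle (R : Matrix (Fin 3) (Fin 3) ℝ) ≤ ρ →
        localRep g (R : Matrix (Fin 3) (Fin 3) ℝ) = φ (R : Matrix (Fin 3) (Fin 3) ℝ) := by
  have hsub : {M : Matrix (Fin 3) (Fin 3) ℝ |
      M ∈ Matrix.specialOrthogonalGroup (Fin 3) ℝ ∧ rotAngle M ≤ ρ} ⊆ openRotBall r := by
    rintro M ⟨hM, hle⟩
    exact ⟨⟨M, hM⟩, rfl, by rw [rotDist_one]; exact hle.trans_lt hρ⟩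
  -- Smoothness gives a local Lipschitz bound, compactness of the smaller ball a global one on it,
  -- and the restriction then extends to all matrices.
  obtain ⟨K, hK⟩ := (hg.diffeo.1.locallyLipschitzOn.mono
    hsub).exists_lipschitzOnWith_of_compact (isCompact_rotAngle_le ρ)
  obtain ⟨φ, hφ, heq⟩ := hK.extend_finite_dimension
  exact ⟨φ, hφ.locallyLipschitz, fun R hR => heq ⟨R.2, hR⟩⟩

lemma continuousOn_SO3_iff {n : ℕ} {R : ℝ → Fin n → SO3} {s : Set ℝ} :
    ContinuousOn R s ↔
      ContinuousOn (fun t i => (R t i : Matrix (Fin 3) (Fin 3) ℝ)) s := by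
  simp_rw [continuousOn_pi]
  exact forall_congr' fun i => Topology.IsInducing.subtypeVal.continuousOn_iff

/-- A solution of the closed loop on the compact interval `[b, c]` that stays in `D`. -/
structure IsSolutionWithin {n : ℕ} (a : Fin n → Fin n → ℝ) (g : ℝ → ℝ)
    (N : ℝ → Fin n → Finset (Fin n)) (D : Set (Fin n → SO3)) (b c : ℝ)
    (R : ℝ → Fin n → SO3) : Prop where
  continuousOn : ContinuousOn R (Icc b c)
  hasDerivWithinAt : ∀ t ∈ Ico b c, ∀ i,
    HasDerivWithinAt (fun s => (R s i : Matrix (Fin 3) (Fin 3) ℝ))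
      ((R t i : Matrix (Fin 3) (Fin 3) ℝ) * hat (controlLaw a g (N t) (R t) i)) (Ici t) t
  mem : ∀ t ∈ Icc b c, R t ∈ D

/-! ### Existence, uniqueness and forward invariance of solutions -/

section Solutions

variable {n : ℕ} {r : ℝ} {g : ℝ → ℝ} {k : ℝ} {a : Fin n → Fin n → ℝ} {q : ℝ}

lemma closedLoopField_eq {φ : Matrix (Fin 3) (Fin 3) ℝ → E3} (hq0 : 0 ≤ q)
    (hq : q < Real.pi / 2)
    (hφ : ∀ R : SO3, rotAngle (R : Matrix (Fin 3) (Fin 3) ℝ) ≤ 2 * q →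
      localRep g (R : Matrix (Fin 3) (Fin 3) ℝ) = φ (R : Matrix (Fin 3) (Fin 3) ℝ))
    (N : Fin n → Finset (Fin n)) {R : Fin n → SO3} (hR : R ∈ closedRotBallPow n q) (i : Fin n) :
    closedLoopField a φ N (fun j => (R j : Matrix (Fin 3) (Fin 3) ℝ)) i =
      (R i : Matrix (Fin 3) (Fin 3) ℝ) * hat (controlLaw a g N R i) := by
  rw [closedLoopField, controlLaw]
  congr 2
  refine Finset.sum_congr rfl fun j _ => ?_
  have := hφ ((R i)⁻¹ * R j) (rotAngle_relative_le hq0 hq hR i j)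
  rw [SO3.coe_transpose_mul] at this
  rw [this]

lemma coe_SO3_mem_closedBall (R : Fin n → SO3) :
    (fun j => (R j : Matrix (Fin 3) (Fin 3) ℝ)) ∈
      Metric.closedBall (0 : Fin n → Matrix (Fin 3) (Fin 3) ℝ) 2 := by
  rw [mem_closedBall_zero_iff, pi_norm_le_iff_of_nonneg (by norm_num)]
  exact fun i => (R i).norm_le_two

/-- Inside the ball both curves solve the ODE of the extended field, which is Lipschitz on the norm
ball of radius `2` containing all rotations, uniformly over the finitely many digraphs. -/
lemma IsSolutionWithin.eqOn (hg : IsLocalRepresentation r g) (hq0 : 0 ≤ q) (hqr : 2 * q < r)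
    {N : ℝ → Fin n → Finset (Fin n)} {b c : ℝ} {R R' : ℝ → Fin n → SO3}
    (hR : IsSolutionWithin a g N (closedRotBallPow n q) b c R)
    (hR' : IsSolutionWithin a g N (closedRotBallPow n q) b c R') (h0 : R b = R' b) :
    EqOn R R' (Icc b c) := by
  have hq : q < Real.pi / 2 := by linarith [hg.r_le_pi]
  obtain ⟨φ, hφ, heq⟩ := hg.exists_lipschitzWith_extension hqr
  have : ProperSpace (Fin n → Matrix (Fin 3) (Fin 3) ℝ) := FiniteDimensional.proper ℝ _
  obtain ⟨K, hK⟩ := exists_common_lipschitzOnWith (locallyLipschitz_closedLoopField a hφ)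
    (isCompact_closedBall (0 : Fin n → Matrix (Fin 3) (Fin 3) ℝ) 2)
  have hder : ∀ {S : ℝ → Fin n → SO3},
      IsSolutionWithin a g N (closedRotBallPow n q) b c S → ∀ t ∈ Ico b c,
      HasDerivWithinAt (fun s j => (S s j : Matrix (Fin 3) (Fin 3) ℝ))
        (closedLoopField a φ (N t) (fun j => (S t j : Matrix (Fin 3) (Fin 3) ℝ))) (Ici t) t := by
    intro S hS t ht
    refine hasDerivWithinAt_pi.2 fun i => ?_
    rw [closedLoopField_eq hq0 hq heq (N t) (hS.mem t ⟨ht.1, ht.2.le⟩)]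
    exact hS.hasDerivWithinAt t ht i
  have key := ODE_solution_unique_of_mem_Icc_right (v := fun t => closedLoopField a φ (N t))
    (s := fun _ => Metric.closedBall 0 2) (fun t _ => hK (N t))
    (continuousOn_SO3_iff.1 hR.continuousOn) (hder hR) (fun t _ => coe_SO3_mem_closedBall _)
    (continuousOn_SO3_iff.1 hR'.continuousOn) (hder hR') (fun t _ => coe_SO3_mem_closedBall _)
    (by rw [h0])
  intro t ht
  funext i
  exact Subtype.ext (congrFun (key ht) i)

lemma IsSolutionWithin.mono {N : ℝ → Fin n → Finset (Fin n)} {D : Set (Fin n → SO3)} {b c c' : ℝ}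
    {R : ℝ → Fin n → SO3} (hR : IsSolutionWithin a g N D b c R) (hc : c' ≤ c) :
    IsSolutionWithin a g N D b c' R :=
  ⟨hR.continuousOn.mono (Icc_subset_Icc_right hc),
    fun t ht => hR.hasDerivWithinAt t ⟨ht.1, ht.2.trans_le hc⟩,
    fun t ht => hR.mem t ⟨ht.1, ht.2.trans hc⟩⟩

/-- Solutions for constant neighborhoods exist on intervals of a uniform length. -/
lemma exists_uniform_isSolutionWithin (hg : IsLocalRepresentation r g) (hk : 0 < k)
    (hgk : ∀ θ ∈ Ico 0 r, k * θ ≤ g θ) (ha : ∀ i j, 0 < a i j) (hq0 : 0 ≤ q) (hqr : 2 * q < r) :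
    ∃ ε > 0, ∀ (N : Fin n → Finset (Fin n)), ∀ R₀ ∈ closedRotBallPow n q, ∀ b : ℝ,
      ∃ R : ℝ → Fin n → SO3, R b = R₀ ∧
        IsSolutionWithin a g (fun _ => N) (closedRotBallPow n q) b (b + ε) R := by
  classical
  -- The extension must agree with the local representation on a slightly larger ball, because
  -- invariance of the `q`-ball is proved by a barrier that may overshoot it.
  obtain ⟨q', hqq', hq'r⟩ : ∃ q', q < q' ∧ 2 * q' < r :=
    ⟨(q + r / 2) / 2, by linarith, by linarith⟩
  have hq' : q' < Real.pi / 2 := by linarith [hg.r_le_pi]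
  obtain ⟨φ, hφ, heq⟩ := hg.exists_lipschitzWith_extension hq'r
  obtain ⟨ε, hε, H⟩ := exists_uniform_integralCurve (locallyLipschitz_closedLoopField a hφ)
    (Metric.isBounded_closedBall (x := (0 : Fin n → Matrix (Fin 3) (Fin 3) ℝ)) (r := 2))
  refine ⟨ε, hε, fun N R₀ hR₀ b => ?_⟩
  obtain ⟨γ, h0, hγc, hγ⟩ := H N _ (coe_SO3_mem_closedBall R₀) b
  have hmem : ∀ i, ∀ t ∈ Icc b (b + ε), γ t i ∈ Matrix.specialOrthogonalGroup (Fin 3) ℝ :=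
    fun i => mem_SO3_of_hasDerivWithinAt (continuousOn_pi.1 hγc i) (by rw [h0]; exact (R₀ i).2)
      (fun t ht => hasDerivWithinAt_pi.1 (hγ t ht) i)
  let R : ℝ → Fin n → SO3 := fun t i =>
    if h : γ t i ∈ Matrix.specialOrthogonalGroup (Fin 3) ℝ then ⟨γ t i, h⟩ else 1
  have hRγ : ∀ t ∈ Icc b (b + ε), ∀ i, (R t i : Matrix (Fin 3) (Fin 3) ℝ) = γ t i := by
    intro t ht i
    simp only [R, dif_pos (hmem i t ht)]
  have hRγ' : ∀ t ∈ Icc b (b + ε), (fun i => (R t i : Matrix (Fin 3) (Fin 3) ℝ)) = γ t :=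
    fun t ht => funext (hRγ t ht)
  have hR0 : R b = R₀ := by
    funext i
    apply Subtype.ext
    rw [hRγ b ⟨le_rfl, by linarith⟩, h0]
  have hcont : ContinuousOn R (Icc b (b + ε)) := continuousOn_SO3_iff.2 (hγc.congr hRγ')
  have hder : ∀ t ∈ Ico b (b + ε), R t ∈ closedRotBallPow n q' → ∀ i,
      HasDerivWithinAt (fun s => (R s i : Matrix (Fin 3) (Fin 3) ℝ))
        ((R t i : Matrix (Fin 3) (Fin 3) ℝ) * hat (controlLaw a g N (R t) i)) (Ici t) t := by
    intro t ht hRt i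
    have ht' : t ∈ Icc b (b + ε) := ⟨ht.1, ht.2.le⟩
    rw [← closedLoopField_eq (hq0.trans hqq'.le) hq' heq N hRt, hRγ' t ht']
    refine (hasDerivWithinAt_pi.1 (hγ t ht) i).congr_of_eventuallyEq ?_ (hRγ t ht' i)
    filter_upwards [Icc_mem_nhdsGE ht.2] with s hs
    exact hRγ s ⟨ht.1.trans hs.1, hs.2⟩ i
  have hinv := mem_closedRotBallPow_of_solution (N := fun _ => N) hk hgk ha hq0 hqq' hq'r
    hg.r_le_pi hcont (by rwa [hR0]) hder
  refine ⟨R, hR0, hcont, fun t ht => hder t ht ?_, hinv⟩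
  exact fun i => (hinv t ⟨ht.1, ht.2.le⟩ i).trans hqq'.le

lemma IsSolutionWithin.glue {N : ℝ → Fin n → Finset (Fin n)} {D : Set (Fin n → SO3)} {b s c : ℝ}
    {R S : ℝ → Fin n → SO3} (hR : IsSolutionWithin a g N D b s R)
    (hS : IsSolutionWithin a g N D s c S) (hs : R s = S s) (hbs : b ≤ s) (hsc : s ≤ c) :
    IsSolutionWithin a g N D b c (fun t => if t ≤ s then R t else S t) := by
  have hright : ∀ t, s ≤ t → (if t ≤ s then R t else S t) = S t := by
    intro t ht
    split_ifs with h
    · rw [le_antisymm h ht, hs]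
    · rfl
  have hleft : ∀ t, t ≤ s → (if t ≤ s then R t else S t) = R t := fun t ht => if_pos ht
  refine ⟨?_, fun t ht i => ?_, fun t ht => ?_⟩
  · rw [← Icc_union_Icc_eq_Icc hbs hsc]
    exact (hR.continuousOn.congr fun t ht => hleft t ht.2).union_of_isClosed
      (hS.continuousOn.congr fun t ht => hright t ht.1) isClosed_Icc isClosed_Icc
  · rcases lt_or_ge t s with h | h
    · simp only [hleft t h.le]
      refine (hR.hasDerivWithinAt t ⟨ht.1, h⟩ i).congr_of_eventuallyEq ?_ (by rw [hleft t h.le])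
      filter_upwards [Icc_mem_nhdsGE h] with u hu
      rw [hleft u hu.2]
    · simp only [hright t h]
      refine (hS.hasDerivWithinAt t ⟨h, ht.2⟩ i).congr_of_eventuallyEq ?_ (by rw [hright t h])
      filter_upwards [self_mem_nhdsWithin] with u hu
      rw [hright u (h.trans hu)]
  · rcases le_total t s with h | h
    · simp only [hleft t h]
      exact hR.mem t ⟨ht.1, h⟩
    · simp only [hright t h]
      exact hS.mem t ⟨h, ht.2⟩

lemma IsSolutionWithin.congr_signal {N N' : ℝ → Fin n → Finset (Fin n)} {D : Set (Fin n → SO3)}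
    {b c : ℝ} {R : ℝ → Fin n → SO3} (hR : IsSolutionWithin a g N D b c R)
    (h : ∀ t ∈ Ico b c, N' t = N t) : IsSolutionWithin a g N' D b c R :=
  ⟨hR.continuousOn, fun t ht i => by rw [h t ht]; exact hR.hasDerivWithinAt t ht i, hR.mem⟩

/-- To the left of each time, a well-behaved signal is constant for a while. -/
lemma IsWellBehaved.exists_left_const {α : Type*} {s : ℝ → α} (hs : IsWellBehaved s) (t : ℝ) :
    ∃ δ > 0, ∀ u ∈ Ioo (t - δ) t, ∀ v ∈ Ioo (t - δ) t, s u = s v := by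
  have hfin := hs.locally_finite (t - 1) t
  -- The time `t` itself may be a switch; the other switches before it form a finite, hence closed,
  -- set that avoids `t`.
  have hclosed : IsClosed ((switchTimes s ∩ Icc (t - 1) t) \ {t}) :=
    (hfin.subset sdiff_subset).isClosed
  have hev : ∀ᶠ u in 𝓝[<] t, u ∈ ((switchTimes s ∩ Icc (t - 1) t) \ {t})ᶜ :=
    nhdsWithin_le_nhds (hclosed.isOpen_compl.mem_nhds (by simp))
  obtain ⟨l, hl, hlt⟩ := (mem_nhdsLT_iff_exists_Ioo_subset).1 hev
  have hl' : l < t := hl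
  refine ⟨min 1 (t - l), lt_min one_pos (by linarith), fun u hu v hv => ?_⟩
  -- With the discrete topology, local constancy is continuity, and a connected interval gives a
  -- constant.
  let _ : TopologicalSpace α := ⊥
  have : DiscreteTopology α := ⟨rfl⟩
  have hcont : ContinuousOn s (Ioo (t - min 1 (t - l)) t) := by
    intro w hw
    have hw1 : t - 1 < w := by linarith [hw.1, min_le_left 1 (t - l)]
    have hw2 : l < w := by linarith [hw.1, min_le_right 1 (t - l)]
    have hnot : w ∉ switchTimes s := fun hsw =>
      hlt ⟨hw2, hw.2⟩ ⟨⟨hsw, hw1.le, hw.2.le⟩, hw.2.ne⟩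
    have hloc : ∀ᶠ u in 𝓝 w, s u = s w := not_not.1 hnot
    exact (ContinuousAt.congr continuousAt_const (hloc.mono fun _ h => h.symm)).continuousWithinAt
  exact isPreconnected_Ioo.constant hcont hu hv

/-- Existence of the solution on arbitrarily long intervals. -/
lemma exists_isSolutionWithin (hg : IsLocalRepresentation r g) (hk : 0 < k)
    (hgk : ∀ θ ∈ Ico 0 r, k * θ ≤ g θ) (ha : ∀ i j, 0 < a i j) (hq0 : 0 ≤ q) (hqr : 2 * q < r)
    {N : ℝ → Fin n → Finset (Fin n)} (hN : IsWellBehaved N) {R₀ : Fin n → SO3}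
    (hR₀ : R₀ ∈ closedRotBallPow n q) (b c : ℝ) :
    ∃ R : ℝ → Fin n → SO3, R b = R₀ ∧
      IsSolutionWithin a g N (closedRotBallPow n q) b c R := by
  obtain ⟨ε, hε, H⟩ := exists_uniform_isSolutionWithin hg hk hgk ha hq0 hqr
  let P : ℝ → Prop := fun c => ∃ R : ℝ → Fin n → SO3, R b = R₀ ∧
      IsSolutionWithin a g N (closedRotBallPow n q) b c R
  have hmono : ∀ s s', s ≤ s' → P s' → P s := fun s s' h ⟨R, h0, hR⟩ => ⟨R, h0, hR.mono h⟩
  have hext : ∀ s s', b ≤ s → s ≤ s' → s' ≤ s + ε → (∀ u ∈ Ico s s', N u = N s) →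
      P s → P s' := by
    rintro s s' hbs hss' hs'ε hconst ⟨R, h0, hR⟩
    obtain ⟨S, hS0, hS⟩ := H (N s) (R s) (hR.mem s ⟨hbs, le_rfl⟩) s
    exact ⟨_, by simp [hbs, h0],
      hR.glue ((hS.mono hs'ε).congr_signal hconst) hS0.symm hbs hss'⟩
  have hPb : P b := by
    obtain ⟨S, hS0, hS⟩ := H (N b) R₀ hR₀ b
    exact ⟨S, hS0, (hS.mono (by linarith)).congr_signal (by simp)⟩
  by_contra hc
  let A : Set ℝ := {s | b ≤ s ∧ P s}
  have hAne : A.Nonempty := ⟨b, le_rfl, hPb⟩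
  have hAbdd : BddAbove A := ⟨c, fun s hs => by
    by_contra hlt
    push Not at hlt
    exact hc (hmono c s hlt.le hs.2)⟩
  set τ := sSup A with hτ
  have hbτ : b ≤ τ := le_csSup hAbdd ⟨le_rfl, hPb⟩
  obtain ⟨δ, hδ, hleft⟩ := hN.exists_left_const τ
  -- From `s` the signal is constant up to `τ`, and the uniform existence time `ε` reaches `τ`; so
  -- the supremum is attained, and right-continuity of the signal carries the solution beyond it.
  obtain ⟨s, ⟨hbs, hPs⟩, hsτ⟩ := exists_lt_of_lt_csSup hAne
    (show τ - min δ ε < τ by linarith [lt_min hδ hε])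
  have hsle : s ≤ τ := le_csSup hAbdd ⟨hbs, hPs⟩
  have hPτ : P τ := by
    refine hext s τ hbs hsle (by linarith [min_le_right δ ε]) (fun u hu => ?_) hPs
    have h1 : τ - δ < s := by linarith [min_le_left δ ε]
    exact hleft u ⟨h1.trans_le hu.1, hu.2⟩ s ⟨h1, hu.1.trans_lt hu.2⟩
  obtain ⟨d, hd, hdτ⟩ := (mem_nhdsGT_iff_exists_Ioo_subset).1 (hN.right_cont τ)
  have hd' : τ < d := hd
  have hnew : P (min d (τ + ε)) := by
    refine hext τ _ hbτ (le_min hd'.le (by linarith)) (min_le_right _ _) (fun u hu => ?_) hPτ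
    rcases hu.1.eq_or_lt with rfl | h
    · rfl
    · exact hdτ ⟨h, hu.2.trans_le (min_le_left _ _)⟩
  have hlt : τ < min d (τ + ε) := lt_min hd' (by linarith)
  exact absurd (le_csSup hAbdd ⟨hbτ.trans hlt.le, hnew⟩) (not_le.2 hlt)

lemma IsSolutionOn.isSolutionWithin (hg : IsLocalRepresentation r g) (hk : 0 < k)
    (hgk : ∀ θ ∈ Ico 0 r, k * θ ≤ g θ) (ha : ∀ i j, 0 < a i j) (hq0 : 0 ≤ q) (hqr : 2 * q < r)
    {N : ℝ → Fin n → Finset (Fin n)} {J : Set ℝ} {b c : ℝ} {R : ℝ → Fin n → SO3}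
    (hR : IsSolutionOn a g N J R) (hJ : Icc b c ⊆ J) (h0 : R b ∈ closedRotBallPow n q) :
    IsSolutionWithin a g N (closedRotBallPow n q) b c R := by
  have hcont := hR.1.mono hJ
  have hder := fun t (ht : t ∈ Ico b c) => hR.2 t (hJ ⟨ht.1, ht.2.le⟩)
  exact ⟨hcont, hder, mem_closedRotBallPow_of_solution hk hgk ha hq0
    (q' := (q + r / 2) / 2) (by linarith) (by linarith) hg.r_le_pi hcont h0
    fun t ht _ => hder t ht⟩

/-- Solutions on `[t₀, c]` agree on overlaps by uniqueness, so `t ↦ S t t` is a solution for all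
later times. A competitor is first shown to remain in the ball, where uniqueness applies. -/
theorem stronglyForwardInvariant_closedRotBallPow (hg : IsLocalRepresentation r g) (hk : 0 < k)
    (hgk : ∀ θ ∈ Ico 0 r, k * θ ≤ g θ) (ha : ∀ i j, 0 < a i j) (hq0 : 0 ≤ q) (hqr : 2 * q < r) :
    StronglyForwardInvariant a g (closedRotBallPow n q) := by
  intro N hN _ t₀ R₀ hR₀
  choose S hS0 hS using exists_isSolutionWithin hg hk hgk ha hq0 hqr hN hR₀ t₀
  have heq : ∀ c c' t, t₀ ≤ t → t ≤ c → t ≤ c' → S c t = S c' t := fun c c' t h0 hc hc' =>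
    ((hS c).mono hc).eqOn hg hq0 hqr ((hS c').mono hc')
      (by rw [hS0 c, hS0 c']) ⟨h0, le_rfl⟩
  have hloc : ∀ c t, t₀ ≤ t → t ≤ c → S t t = S c t := fun c t h0 hc => heq t c t h0 le_rfl hc
  refine ⟨fun t => S t t, ⟨fun t ht => ?_, fun t ht i => ?_⟩, hS0 t₀,
    fun t ht => (hS t).mem t ⟨ht, le_rfl⟩, fun T R' hR' h0' t ht => ?_⟩
  · have ht' : t₀ ≤ t := ht
    have h1 : ContinuousWithinAt (S (t + 1)) (Icc t₀ (t + 1)) t :=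
      (hS (t + 1)).continuousOn t ⟨ht', by linarith⟩
    have h2 : ContinuousWithinAt (fun t => S t t) (Icc t₀ (t + 1)) t :=
      h1.congr (fun u hu => hloc _ u hu.1 hu.2) (hloc _ t ht' (by linarith))
    refine h2.mono_of_mem_nhdsWithin ?_
    filter_upwards [self_mem_nhdsWithin,
      mem_nhdsWithin_of_mem_nhds (Iic_mem_nhds (show t < t + 1 by linarith))] with u hu hu'
    exact ⟨hu, hu'⟩
  · have ht' : t₀ ≤ t := ht
    simp only [hloc (t + 1) t ht' (by linarith)]
    refine ((hS (t + 1)).hasDerivWithinAt t ⟨ht', by linarith⟩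
      i).congr_of_eventuallyEq ?_ (by rw [hloc (t + 1) t ht' (by linarith)])
    filter_upwards [Icc_mem_nhdsGE (show t < t + 1 by linarith)] with u hu
    rw [hloc (t + 1) u (ht'.trans hu.1) hu.2]
  · have h := hR'.isSolutionWithin hg hk hgk ha hq0 hqr (b := t₀) (c := t)
      (fun u hu => ⟨hu.1, hu.2.trans_lt ht.2⟩) (by rwa [h0'])
    exact h.eqOn hg hq0 hqr (hS t) (by rw [h0', hS0 t]) ⟨ht.1, le_rfl⟩

end Solutions

/-! ### Chordal and Riemannian distances, and exponential stability -/

/-- The squared Frobenius distance of two rotations in terms of the relative rotation. -/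
lemma SO3.norm_sub_sq (P Q : SO3) :
    ‖(P : Matrix (Fin 3) (Fin 3) ℝ) - (Q : Matrix (Fin 3) (Fin 3) ℝ)‖ ^ 2 =
      2 * (3 - ((P : Matrix (Fin 3) (Fin 3) ℝ)ᵀ * (Q : Matrix (Fin 3) (Fin 3) ℝ)).trace) := by
  rw [Matrix.frobenius_norm_sq_eq_trace]
  have h : ((P : Matrix (Fin 3) (Fin 3) ℝ) - (Q : Matrix (Fin 3) (Fin 3) ℝ))ᵀ *
      ((P : Matrix (Fin 3) (Fin 3) ℝ) - (Q : Matrix (Fin 3) (Fin 3) ℝ)) =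
      (P : Matrix (Fin 3) (Fin 3) ℝ)ᵀ * P - (P : Matrix (Fin 3) (Fin 3) ℝ)ᵀ * Q -
        (Q : Matrix (Fin 3) (Fin 3) ℝ)ᵀ * P + (Q : Matrix (Fin 3) (Fin 3) ℝ)ᵀ * Q := by
    rw [Matrix.transpose_sub]
    noncomm_ring
  rw [h, P.transpose_mul_self, Q.transpose_mul_self, Matrix.trace_add, Matrix.trace_sub,
    Matrix.trace_sub, trace_transpose_mul_comm (Q : Matrix (Fin 3) (Fin 3) ℝ) P,
    Matrix.trace_one, Fintype.card_fin]
  push_cast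
  ring

/-- The triangle inequality for the Frobenius norm, squared with `(y + z)² ≤ 2y² + 2z²`. -/
lemma SO3.three_sub_trace_le_two_mul (P Q S : SO3) :
    3 - ((P : Matrix (Fin 3) (Fin 3) ℝ)ᵀ * (Q : Matrix (Fin 3) (Fin 3) ℝ)).trace ≤
      2 * (3 - ((P : Matrix (Fin 3) (Fin 3) ℝ)ᵀ * (S : Matrix (Fin 3) (Fin 3) ℝ)).trace) +
      2 * (3 - ((Q : Matrix (Fin 3) (Fin 3) ℝ)ᵀ * (S : Matrix (Fin 3) (Fin 3) ℝ)).trace) := by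
  have h1 := P.norm_sub_sq Q
  have h2 := P.norm_sub_sq S
  have h3 := Q.norm_sub_sq S
  have h4 := norm_sub_le_norm_sub_add_norm_sub (P : Matrix (Fin 3) (Fin 3) ℝ)
    (S : Matrix (Fin 3) (Fin 3) ℝ) (Q : Matrix (Fin 3) (Fin 3) ℝ)
  rw [norm_sub_rev (S : Matrix (Fin 3) (Fin 3) ℝ) (Q : Matrix (Fin 3) (Fin 3) ℝ)] at h4
  set x := ‖(P : Matrix (Fin 3) (Fin 3) ℝ) - (Q : Matrix (Fin 3) (Fin 3) ℝ)‖
  set y := ‖(P : Matrix (Fin 3) (Fin 3) ℝ) - (S : Matrix (Fin 3) (Fin 3) ℝ)‖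
  set z := ‖(Q : Matrix (Fin 3) (Fin 3) ℝ) - (S : Matrix (Fin 3) (Fin 3) ℝ)‖
  have h5 : x ^ 2 ≤ (y + z) ^ 2 := pow_le_pow_left₀ (norm_nonneg _) h4 2
  nlinarith [sq_nonneg (y - z)]

lemma two_mul_cos_rotAngle {R : SO3} (h : -1 ≤ (R : Matrix (Fin 3) (Fin 3) ℝ).trace) :
    2 * Real.cos (rotAngle (R : Matrix (Fin 3) (Fin 3) ℝ)) =
      (R : Matrix (Fin 3) (Fin 3) ℝ).trace - 1 := by
  have := R.trace_le_three
  rw [rotAngle, Real.cos_arccos (by linarith) (by linarith)]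
  ring

/-- The squared chordal distance is at most the squared angle. -/
lemma three_sub_trace_le_rotAngle_sq {R : SO3} (h : -1 ≤ (R : Matrix (Fin 3) (Fin 3) ℝ).trace) :
    3 - (R : Matrix (Fin 3) (Fin 3) ℝ).trace ≤
      rotAngle (R : Matrix (Fin 3) (Fin 3) ℝ) ^ 2 := by
  have h1 := two_mul_cos_rotAngle h
  have h2 := Real.one_sub_sq_div_two_le_cos (x := rotAngle (R : Matrix (Fin 3) (Fin 3) ℝ))
  linarith

/-- The squared angle is at most a multiple of the squared chordal distance. -/
lemma rotAngle_sq_le {R : SO3} (h : -1 ≤ (R : Matrix (Fin 3) (Fin 3) ℝ).trace) :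
    rotAngle (R : Matrix (Fin 3) (Fin 3) ℝ) ^ 2 ≤
      Real.pi ^ 2 / 4 * (3 - (R : Matrix (Fin 3) (Fin 3) ℝ).trace) := by
  have h1 := two_mul_cos_rotAngle h
  have h2 := Real.cos_le_one_sub_mul_cos_sq (x := rotAngle (R : Matrix (Fin 3) (Fin 3) ℝ))
    ((abs_of_nonneg (Real.arccos_nonneg _)).trans_le (Real.arccos_le_pi _))
  set θ := rotAngle (R : Matrix (Fin 3) (Fin 3) ℝ)
  have h3 : 4 / Real.pi ^ 2 * θ ^ 2 ≤ 3 - (R : Matrix (Fin 3) (Fin 3) ℝ).trace := by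
    have e : 4 / Real.pi ^ 2 * θ ^ 2 = 2 * (2 / Real.pi ^ 2 * θ ^ 2) := by ring
    linarith
  have hπ := Real.pi_pos
  calc θ ^ 2 = Real.pi ^ 2 / 4 * (4 / Real.pi ^ 2 * θ ^ 2) := by field_simp
    _ ≤ _ := by gcongr

section Stability

variable {n : ℕ} {q : ℝ}

lemma configDist_nonneg (R S : Fin n → SO3) : 0 ≤ configDist R S := Real.sqrt_nonneg _

lemma configDistToSet_nonneg (R : Fin n → SO3) (D : Set (Fin n → SO3)) :
    0 ≤ configDistToSet R D := by
  refine Real.sInf_nonneg ?_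
  rintro _ ⟨S, -, rfl⟩
  exact configDist_nonneg R S

lemma configDistToSet_le (R : Fin n → SO3) {D : Set (Fin n → SO3)} {S : Fin n → SO3}
    (hS : S ∈ D) : configDistToSet R D ≤ configDist R S :=
  csInf_le ⟨0, by rintro _ ⟨S, -, rfl⟩; exact configDist_nonneg R S⟩ ⟨S, hS, rfl⟩

lemma const_mem_synchronizedSet {R : Fin n → SO3} (hR : R ∈ closedRotBallPow n q) (i : Fin n) :
    (fun _ => R i) ∈ synchronizedSet n q :=
  ⟨fun _ => hR i, fun _ _ => rfl⟩

lemma sq_rotDist_le_sq_configDist (R S : Fin n → SO3) (i : Fin n) :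
    rotDist (R i) (S i) ^ 2 ≤ configDist R S ^ 2 := by
  rw [configDist, Real.sq_sqrt (by positivity)]
  exact Finset.single_le_sum (f := fun i => rotDist (R i) (S i) ^ 2)
    (fun i _ => sq_nonneg _) (Finset.mem_univ i)

lemma neg_one_le_trace_relative (hq0 : 0 ≤ q) (hq : q < Real.pi / 2) {P Q : SO3}
    (hP : rotDist 1 P ≤ q) (hQ : rotDist 1 Q ≤ q) :
    -1 ≤ ((P⁻¹ * Q : SO3) : Matrix (Fin 3) (Fin 3) ℝ).trace := by
  have hπ : q < Real.pi := by linarith [Real.pi_pos]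
  rw [rotDist_one] at hP hQ
  have := SO3.trace_transpose_mul_ge (Real.cos_pos_of_mem_Ioo ⟨by linarith, hq⟩)
    (one_add_two_cos_le_trace hπ hP) (one_add_two_cos_le_trace hπ hQ)
  rw [SO3.coe_transpose_mul]
  nlinarith [sq_nonneg (Real.cos q)]

/-- Relative distances are controlled by the distance to the synchronized configurations. -/
lemma three_sub_trace_le_configDistToSet (hq0 : 0 ≤ q) (hq : q < Real.pi / 2)
    {R : Fin n → SO3} (hR : R ∈ closedRotBallPow n q) (i j : Fin n) :
    3 - ((R i : Matrix (Fin 3) (Fin 3) ℝ)ᵀ * (R j : Matrix (Fin 3) (Fin 3) ℝ)).trace ≤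
      4 * configDistToSet R (synchronizedSet n q) ^ 2 := by
  set T := 3 - ((R i : Matrix (Fin 3) (Fin 3) ℝ)ᵀ * (R j : Matrix (Fin 3) (Fin 3) ℝ)).trace
  have key : Real.sqrt T / 2 ≤ configDistToSet R (synchronizedSet n q) := by
    refine le_csInf ⟨_, _, const_mem_synchronizedSet hR i, rfl⟩ ?_
    rintro _ ⟨S, hS, rfl⟩
    have hpart : ∀ l, 3 - ((R l : Matrix (Fin 3) (Fin 3) ℝ)ᵀ *
        (S l : Matrix (Fin 3) (Fin 3) ℝ)).trace ≤ configDist R S ^ 2 := fun l =>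
      (three_sub_trace_le_rotAngle_sq (neg_one_le_trace_relative hq0 hq (hR l) (hS.1 l))).trans
        (sq_rotDist_le_sq_configDist R S l)
    -- The common value of the synchronized configuration `S` is the intermediate point; the two
    -- halves contribute `2 + 2 = 4`.
    have h1 := SO3.three_sub_trace_le_two_mul (R i) (R j) (S i)
    have h2 := hpart i
    have h3 := hpart j
    rw [hS.2 j i] at h3
    have h4 : T ≤ (2 * configDist R S) ^ 2 := by linarith
    have h5 := Real.sqrt_le_sqrt h4
    rw [Real.sqrt_sq (mul_nonneg zero_le_two (configDist_nonneg R S))] at h5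
    linarith
  rcases le_total T 0 with h | h
  · exact h.trans (by positivity)
  · have h1 := pow_le_pow_left₀ (by positivity) key 2
    rw [div_pow, Real.sq_sqrt h] at h1
    linarith

/-- The distance to the synchronized configurations is controlled by relative distances. -/
lemma configDistToSet_le_of_three_sub_trace_le (hq0 : 0 ≤ q) (hq : q < Real.pi / 2)
    {R : Fin n → SO3} (hR : R ∈ closedRotBallPow n q) {d : ℝ} (hd : 0 ≤ d)
    (h : ∀ i j, 3 - ((R i : Matrix (Fin 3) (Fin 3) ℝ)ᵀ *
      (R j : Matrix (Fin 3) (Fin 3) ℝ)).trace ≤ 4 * d ^ 2) :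
    configDistToSet R (synchronizedSet n q) ≤ Real.pi * Real.sqrt n * d := by
  have hπ := Real.pi_pos
  rcases isEmpty_or_nonempty (Fin n) with hn | ⟨⟨i₀⟩⟩
  · have hmem : R ∈ synchronizedSet n q := ⟨hR, fun i => hn.elim i⟩
    -- Moving every agent to the position of one of them is a competitor in the synchronized set.
    refine (configDistToSet_le R hmem).trans ?_
    rw [configDist, Finset.univ_eq_empty, Finset.sum_empty, Real.sqrt_zero]
    positivity
  · refine (configDistToSet_le R (const_mem_synchronizedSet hR i₀)).trans ?_
    refine Real.sqrt_le_iff.2 ⟨by positivity, ?_⟩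
    have hterm : ∀ i, rotDist (R i) (R i₀) ^ 2 ≤ Real.pi ^ 2 * d ^ 2 := by
      intro i
      have h1 := rotAngle_sq_le (neg_one_le_trace_relative hq0 hq (hR i) (hR i₀))
      rw [SO3.coe_transpose_mul] at h1
      calc rotDist (R i) (R i₀) ^ 2 ≤ _ := h1
        _ ≤ Real.pi ^ 2 / 4 * (4 * d ^ 2) := by gcongr; exact h i i₀
        _ = _ := by ring
    calc ∑ i, rotDist (R i) (R i₀) ^ 2 ≤ ∑ _i : Fin n, Real.pi ^ 2 * d ^ 2 :=
          Finset.sum_le_sum fun i _ => hterm i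
      _ = n * (Real.pi ^ 2 * d ^ 2) := by simp
      _ = (Real.pi * Real.sqrt n * d) ^ 2 := by
          rw [mul_pow, mul_pow, Real.sq_sqrt (Nat.cast_nonneg n)]
          ring

lemma exists_pos_le_weights {a : Fin n → Fin n → ℝ} (ha : ∀ i j, 0 < a i j) :
    ∃ α > 0, ∀ i j, α ≤ a i j := by
  rcases isEmpty_or_nonempty (Fin n × Fin n) with h | h
  · exact ⟨1, one_pos, fun i j => h.elim (i, j)⟩
  · obtain ⟨p, hp⟩ := Finite.exists_min fun p : Fin n × Fin n => a p.1 p.2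
    exact ⟨a p.1 p.2, ha _ _, fun i j => hp (i, j)⟩

theorem globallyExponentiallyStableRel_synchronizedSet {r : ℝ} {g : ℝ → ℝ} {k : ℝ}
    {a : Fin n → Fin n → ℝ} (hg : IsLocalRepresentation r g) (hk : 0 < k)
    (hgk : ∀ θ ∈ Ico 0 r, k * θ ≤ g θ) (ha : ∀ i j, 0 < a i j) (hq0 : 0 ≤ q) (hqr : 2 * q < r)
    {N : ℝ → Fin n → Finset (Fin n)} (hedge : ∀ t i j, j ∈ N t i ∨ i ∈ N t j) :
    GloballyExponentiallyStableRel a g N (synchronizedSet n q) (closedRotBallPow n q) := by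
  have hq : q < Real.pi / 2 := by linarith [hg.r_le_pi]
  have hcos := Real.cos_pos_of_mem_Ioo (x := q) ⟨by linarith, hq⟩
  have hπ := Real.pi_pos
  obtain ⟨α, hα0, hα⟩ := exists_pos_le_weights ha
  set ρ := α * k * Real.cos q ^ 2 with hρ
  have hρ0 : 0 < ρ := by positivity
  -- The rate is halved because `ρ` governs squared distances; the summand `1` keeps the constant
  -- positive when `n = 0`.
  refine ⟨Real.pi * Real.sqrt n + 1, by positivity, ρ / 2, by positivity, fun t₀ R hR h0 t ht => ?_⟩
  have hsol := hR.isSolutionWithin hg hk hgk ha hq0 hqr (b := t₀) (c := t)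
    Icc_subset_Ici_self h0
  set d₀ := configDistToSet (R t₀) (synchronizedSet n q) with hd₀
  have hd₀0 : 0 ≤ d₀ := configDistToSet_nonneg _ _
  have hdecay := three_sub_trace_le_of_solution hk hgk hα0 hα hq0 hqr hg.r_le_pi hedge
    hsol.continuousOn hsol.mem hsol.hasDerivWithinAt (V := 4 * d₀ ^ 2) (by positivity)
    (three_sub_trace_le_configDistToSet hq0 hq h0) t ⟨ht, le_rfl⟩
  have hexp : Real.exp (-ρ * (t - t₀)) = Real.exp (-(ρ / 2) * (t - t₀)) ^ 2 := by
    rw [← Real.exp_nat_mul]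
    congr 1
    push_cast
    ring
  have hfin := configDistToSet_le_of_three_sub_trace_le hq0 hq (hsol.mem t ⟨ht, le_rfl⟩)
    (d := d₀ * Real.exp (-(ρ / 2) * (t - t₀))) (by positivity) fun i j => by
      refine (hdecay i j).trans_eq ?_
      rw [hexp]
      ring
  have hnn : 0 ≤ Real.exp (-(ρ / 2) * (t - t₀)) * d₀ := by positivity
  linarith

end Stability

/-! ### The proposition, including negative radii -/

theorem mainTheorem4 (n : ℕ)
    (r : ℝ) (g : ℝ → ℝ) (hg : IsLocalRepresentation r g)
    (k : ℝ) (hk : 0 < k) (hgk : ∀ θ ∈ Ico 0 r, k * θ ≤ g θ)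
    (a : Fin n → Fin n → ℝ) (ha : ∀ i j, 0 < a i j)
    (τD : ℝ) (hτD : 0 < τD)
    (N : ℝ → Fin n → Finset (Fin n))
    (hN : ∀ i, HasDwellTime τD (fun t => N t i))
    (hself : ∀ t i, i ∈ N t i)
    (hedge : ∀ t i j, j ∈ N t i ∨ i ∈ N t j)
    (q : ℝ) (hq : q < r / 2) :
    StronglyForwardInvariant a g (closedRotBallPow n q) ∧
      GloballyExponentiallyStableRel a g N (synchronizedSet n q) (closedRotBallPow n q) := by
  have hqr : ∀ {q' : ℝ}, q' < r / 2 → 2 * q' < r := fun h => by linarith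
  rcases le_or_gt 0 q with hq0 | hq0
  · exact ⟨stronglyForwardInvariant_closedRotBallPow hg hk hgk ha hq0 (hqr hq),
      globallyExponentiallyStableRel_synchronizedSet hg hk hgk ha hq0 (hqr hq) hedge⟩
  -- For `q < 0` the ball is empty as soon as there is an agent. Without agents it is the whole
  -- one-point space, the same as for radius `0`.
  · rcases isEmpty_or_nonempty (Fin n) with hn | ⟨⟨i⟩⟩
    · have hball : closedRotBallPow n q = closedRotBallPow n 0 :=
        Set.ext fun R => ⟨fun _ i => hn.elim i, fun _ i => hn.elim i⟩
      have hsync : synchronizedSet n q = synchronizedSet n 0 := by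
        rw [synchronizedSet, synchronizedSet, hball]
      have h0r : (0 : ℝ) < r / 2 := half_pos hg.r_pos
      rw [hball, hsync]
      exact ⟨stronglyForwardInvariant_closedRotBallPow hg hk hgk ha le_rfl (hqr h0r),
        globallyExponentiallyStableRel_synchronizedSet hg hk hgk ha le_rfl (hqr h0r) hedge⟩
    · have hempty : ∀ R, R ∉ closedRotBallPow n q := fun R hR =>
        absurd ((Real.arccos_nonneg _).trans (hR i)) (not_le.2 hq0)
      exact ⟨fun _ _ _ _ R hR => absurd hR (hempty R),
        1, one_pos, 1, one_pos, fun _ _ _ h0 => absurd h0 (hempty _)⟩
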